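/- Let $X$ be a set and let $G$ be a group generated by $X$ via a map $\iota\colon X\to G$ (not necessarily injective). The Cayley graph $\Gamma_X$ of $G$ has vertex set $G$ and, for every $g\in G$ and every letter $a\in X\cup X^{-1}$ (with $X^{-1}$ a set of formal inverses), an edge labelled $a$ from $g$ to $ga_G$, where $a_G\in G$ is the value of $a$; its inverse edge is the edge labelled $a^{-1}$ from $ga_G$ to $g$. A subgraph is a set of vertices and edges closed under taking endpoints and inverse edges. Let $\operatorname{Sub}\Gamma_X$ be the poset of all subgraphs (including the empty one) and $\operatorname{CSub}\Gamma_X$ the poset of connected (nonempty) subgraphs, both ordered by inclusion; $G$ acts on both by left translation. A closure operator $c$ on $P=\operatorname{Sub}\Gamma_X$ or $P=\operatorname{CSub}\Gamma_X$ is an extensive, monotone and idempotent map $\Delta\mapsto\Delta^c$; it is $G$-invariant if $(g\Delta)^c=g(\Delta^c)$ for all $g\in G$ and $\Delta\in P$, and finitary if $\Delta^c=\bigcup\{F^c : F\in P,\ F\subseteq\Delta,\ F\text{ finite}\}$ for all $\Delta\in P$. Let $\mathcal C(X,G)$ be the category of $G$-invariant finitary closure operators on $\operatorname{CSub}\Gamma_X$,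 and $\mathcal S(X,G)$ the category of $G$-invariant finitary closure operators on $\operatorname{Sub}\Gamma_X$ for which the empty subgraph is closed; in both, there is a (single) morphism $c\to c'$ exactly when $\Delta^c\subseteq\Delta^{c'}$ for all $\Delta\in P$. For an inverse monoid $S$ let $\sigma$ be its least congruence whose quotient is a group. $S$ is $E$-unitary if the $\sigma$-class of $1$ consists exactly of the idempotents of $S$, and $S$ is $F$-inverse if every $\sigma$-class has a greatest element in the natural partial order; then $s^{\mathfrak m}$ denotes the greatest element of the $\sigma$-class of $s$. A monoid $S$ of either kind, with a map $\iota_S\colon X\to S$, has greatest group image $G$ if there is a surjective homomorphism $\pi\colon S\to G$ with kernel $\sigma$ and $\pi\circ\iota_S=\iota$. Let $\mathcal E(X,G)$ be the category of $E$-unitary inverse monoids that are $X$-generated in the signature $(\cdot,1,{}^{-1})$ and have greatest group image $G$, and $\mathcal F(X,G)$ the category of $F$-inverse monoids that are $X$-generated in the signature $(\cdot,1,{}^{-1},{}^{\mathfrak m})$ and have greatest group image $G$; in both, the morphisms $S\to T$ are the homomorphisms $\varphi$ in the respective signature with $\varphi\circ\iota_S=\iota_T$. Then: 1. the categories $\mathcal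 E(X,G)$ and $\mathcal C(X,G)$ are equivalent; 2. the categories $\mathcal F(X,G)$ and $\mathcal S(X,G)$ are equivalent. -/

import Mathlib

open CategoryTheory

universe u v

/-- An inverse monoid, in the signature `(·, 1, ⁻¹)`: every `a` has a unique inverse `a⁻¹`, i.e. a
unique element `b` with `a * b * a = a` and `b * a * b = b`. -/
class InverseMonoid (S : Type u) extends Monoid S, Inv S where
  mul_inv_mul : ∀ a : S, a * a⁻¹ * a = a
  inv_mul_inv : ∀ a : S, a⁻¹ * a * a⁻¹ = a⁻¹
  inv_unique : ∀ a b : S, a * b * a = a → b * a * b = b → b = a⁻¹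

namespace InverseMonoid

/-- The natural partial order of an inverse monoid. -/
def NatLE {S : Type u} [InverseMonoid S] (a b : S) : Prop := a = a * a⁻¹ * b

/-- A congruence on an inverse monoid whose quotient is a group (with the class of `s⁻¹` as the
group inverse of the class of `s`). -/
def IsGroupCon {S : Type u} [InverseMonoid S] (c : Con S) : Prop :=
  ∀ s : S, c (s * s⁻¹) 1 ∧ c (s⁻¹ * s) 1

/-- The congruence `σ`: the least congruence whose quotient is a group. -/
def sigma (S : Type u) [InverseMonoid S] : Con S := sInf {c : Con S | IsGroupCon c}

/-- `S` is `E`-unitary: the greatest group morphism `S → S/σ` is idempotent pure, i.e. the preimage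
of `1` is the set of idempotents. -/
def IsEUnitary (S : Type u) [InverseMonoid S] : Prop :=
  ∀ s : S, sigma S s 1 ↔ s * s = s

/-- `S` is generated by `ι(X)` in the signature `(·, 1, ⁻¹)`: the only subset containing `ι(X)`
and closed under the operations is `S` itself. -/
def IsGeneratedBy {X : Type u} {S : Type v} [InverseMonoid S] (ι : X → S) : Prop :=
  ∀ T : Set S, (∀ x, ι x ∈ T) → 1 ∈ T → (∀ a ∈ T, ∀ b ∈ T, a * b ∈ T) → (∀ a ∈ T, a⁻¹ ∈ T) →
    T = Set.univ

/-- The morphism `π : S → G` onto a group is the natural morphism onto the greatest group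
image of `S`: it is onto, and its kernel is `σ`. -/
def IsGreatestGroupImage {S : Type u} [InverseMonoid S] {G : Type v} [Group G] (π : S →* G) :
    Prop :=
  Function.Surjective π ∧ ∀ a b : S, π a = π b ↔ sigma S a b

end InverseMonoid

/-- An `F`-inverse monoid, in the signature `(·, 1, ⁻¹, ᵐ)`: an inverse monoid in which every
`σ`-class has a greatest element for the natural partial order; `maxElt a` is the greatest element
of the `σ`-class of `a`. -/
class FInverseMonoid (S : Type u) extends InverseMonoid S where
  maxElt : S → S
  maxElt_sigma : ∀ a : S, InverseMonoid.sigma S (maxElt a) a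
  le_maxElt : ∀ a b : S, InverseMonoid.sigma S b a → InverseMonoid.NatLE b (maxElt a)

/-- `S` is generated by `ι(X)` in the signature `(·, 1, ⁻¹, ᵐ)`. -/
def FInverseMonoid.IsGeneratedBy {X : Type u} {S : Type v} [FInverseMonoid S] (ι : X → S) : Prop :=
  ∀ T : Set S, (∀ x, ι x ∈ T) → 1 ∈ T → (∀ a ∈ T, ∀ b ∈ T, a * b ∈ T) → (∀ a ∈ T, a⁻¹ ∈ T) →
    (∀ a ∈ T, FInverseMonoid.maxElt a ∈ T) → T = Set.univ

/-! ### The category of `X`-generated `E`-unitary inverse monoids with greatest group image `G` -/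

/-- An `X`-generated `E`-unitary inverse monoid with greatest group image the `X`-generated
group `(G, ι)`; the natural morphism onto `G` is canonical, i.e. respects the generators. -/
structure EUnitaryOver {X : Type u} {G : Type v} [Group G] (ι : X → G) where
  carrier : Type (max u v)
  [inverseMonoid : InverseMonoid carrier]
  gen : X → carrier
  generated : InverseMonoid.IsGeneratedBy gen
  eUnitary : InverseMonoid.IsEUnitary carrier
  proj : carrier →* G
  proj_gen : ∀ x, proj (gen x) = ι x
  proj_greatest : InverseMonoid.IsGreatestGroupImage proj

namespace EUnitaryOver

attribute [instance] EUnitaryOver.inverseMonoid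

variable {X : Type u} {G : Type v} [Group G] {ι : X → G}

/-- A canonical homomorphism of inverse monoids. -/
@[ext]
structure Hom (S T : EUnitaryOver ι) where
  toMonoidHom : S.carrier →* T.carrier
  map_inv : ∀ a, toMonoidHom a⁻¹ = (toMonoidHom a)⁻¹
  map_gen : ∀ x, toMonoidHom (S.gen x) = T.gen x

instance : Category (EUnitaryOver ι) where
  Hom S T := Hom S T
  id S := ⟨MonoidHom.id _, fun _ => rfl, fun _ => rfl⟩
  comp f g := ⟨g.toMonoidHom.comp f.toMonoidHom,
    fun a => by simp [f.map_inv, g.map_inv],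
    fun x => by simp [f.map_gen, g.map_gen]⟩

end EUnitaryOver

/-! ### The category of `X`-generated `F`-inverse monoids with greatest group image `G` -/

/-- An `F`-inverse monoid, `X`-generated in the signature `(·, 1, ⁻¹, ᵐ)`, with greatest group
image the `X`-generated group `(G, ι)`. -/
structure FInverseOver {X : Type u} {G : Type v} [Group G] (ι : X → G) where
  carrier : Type (max u v)
  [fInverseMonoid : FInverseMonoid carrier]
  gen : X → carrier
  generated : FInverseMonoid.IsGeneratedBy gen
  proj : carrier →* G
  proj_gen : ∀ x, proj (gen x) = ι x
  proj_greatest : InverseMonoid.IsGreatestGroupImage proj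

namespace FInverseOver

attribute [instance] FInverseOver.fInverseMonoid

variable {X : Type u} {G : Type v} [Group G] {ι : X → G}

/-- A canonical homomorphism of `F`-inverse monoids. -/
@[ext]
structure Hom (S T : FInverseOver ι) where
  toMonoidHom : S.carrier →* T.carrier
  map_inv : ∀ a, toMonoidHom a⁻¹ = (toMonoidHom a)⁻¹
  map_maxElt : ∀ a, toMonoidHom (FInverseMonoid.maxElt a) = FInverseMonoid.maxElt (toMonoidHom a)
  map_gen : ∀ x, toMonoidHom (S.gen x) = T.gen x

instance : Category (FInverseOver ι) where
  Hom S T := Hom S T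
  id S := ⟨MonoidHom.id _, fun _ => rfl, fun _ => rfl, fun _ => rfl⟩
  comp f g := ⟨g.toMonoidHom.comp f.toMonoidHom,
    fun a => by simp [f.map_inv, g.map_inv],
    fun a => by simp [f.map_maxElt, g.map_maxElt],
    fun x => by simp [f.map_gen, g.map_gen]⟩

end FInverseOver

/-! ### The Cayley graph and its subgraphs -/

namespace Cayley

variable {X : Type u} {G : Type v} [Group G]

/-- The value in `G` of a letter of `X ∪ X⁻¹`; `(x, true)` stands for `x` and `(x, false)` for the
formal inverse `x⁻¹`. -/
def letterVal (ι : X → G) (a : X × Bool) : G := if a.2 then ι a.1 else (ι a.1)⁻¹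

/-- The edges of the Cayley graph: `(g, a)` is the edge with label `a` starting at `g`. -/
abbrev Edge (_ : X → G) : Type (max u v) := G × (X × Bool)

/-- The initial vertex of an edge. -/
def Edge.source {ι : X → G} (e : Edge ι) : G := e.1

/-- The terminal vertex of an edge. -/
def Edge.target {ι : X → G} (e : Edge ι) : G := e.1 * letterVal ι e.2

/-- The inverse of an edge. -/
def Edge.inverse {ι : X → G} (e : Edge ι) : Edge ι := (Edge.target e, (e.2.1, !e.2.2))

/-- The left action of `G` on edges. -/
def Edge.translate {ι : X → G} (g : G) (e : Edge ι) : Edge ι := (g * e.1, e.2)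

/-- A subgraph of the Cayley graph: a set of vertices and a set of edges, closed under taking
initial and terminal vertices and inverse edges. The empty subgraph is allowed. -/
@[ext]
structure Sub (ι : X → G) where
  verts : Set G
  edges : Set (Edge ι)
  source_mem : ∀ e ∈ edges, Edge.source e ∈ verts
  target_mem : ∀ e ∈ edges, Edge.target e ∈ verts
  inverse_mem : ∀ e ∈ edges, Edge.inverse e ∈ edges

namespace Sub

variable {ι : X → G}

/-- Subgraphs are ordered by inclusion. -/
instance : PartialOrder (Sub ι) where
  le A B := A.verts ⊆ B.verts ∧ A.edges ⊆ B.edges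
  le_refl _ := ⟨subset_rfl, subset_rfl⟩
  le_trans _ _ _ h k := ⟨h.1.trans k.1, h.2.trans k.2⟩
  le_antisymm _ _ h k := Sub.ext (h.1.antisymm k.1) (h.2.antisymm k.2)

/-- The empty subgraph. -/
def empty (ι : X → G) : Sub ι where
  verts := ∅
  edges := ∅
  source_mem _ h := h.elim
  target_mem _ h := h.elim
  inverse_mem _ h := h.elim

/-- A subgraph is finite if it has finitely many vertices and edges. -/
def IsFinite (A : Sub ι) : Prop := A.verts.Finite ∧ A.edges.Finite

/-- The image `gΔ` of a subgraph `Δ` under the left action of `g`. -/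
def translate (g : G) (A : Sub ι) : Sub ι where
  verts := (fun v => g * v) '' A.verts
  edges := Edge.translate g '' A.edges
  source_mem := by
    rintro _ ⟨e, he, rfl⟩
    exact ⟨_, A.source_mem e he, rfl⟩
  target_mem := by
    rintro _ ⟨e, he, rfl⟩
    exact ⟨_, A.target_mem e he, by simp [Edge.target, Edge.translate, mul_assoc]⟩
  inverse_mem := by
    rintro _ ⟨e, he, rfl⟩
    exact ⟨_, A.inverse_mem e he, by
      simp [Edge.target, Edge.translate, Edge.inverse, mul_assoc]⟩

/-- There is an edge of the subgraph from `g` to `h`. -/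
def Step (A : Sub ι) (g h : G) : Prop := ∃ e ∈ A.edges, Edge.source e = g ∧ Edge.target e = h

/-- A subgraph is connected if it is nonempty and any two of its vertices are joined by a
(possibly empty) path in it. -/
def IsConnected (A : Sub ι) : Prop :=
  A.verts.Nonempty ∧ ∀ g ∈ A.verts, ∀ h ∈ A.verts, Relation.ReflTransGen A.Step g h

theorem IsConnected.translate {A : Sub ι} (hA : A.IsConnected) (g : G) :
    (A.translate g).IsConnected := by
  refine ⟨hA.1.image _, ?_⟩
  rintro _ ⟨a, ha, rfl⟩ _ ⟨b, hb, rfl⟩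
  refine Relation.ReflTransGen.lift (fun v => g * v) ?_ _ _ (hA.2 a ha b hb)
  rintro _ _ ⟨e, he, rfl, rfl⟩
  exact ⟨_, ⟨e, he, rfl⟩, rfl, by simp [Edge.target, Edge.translate, mul_assoc]⟩

end Sub

/-- The poset of connected subgraphs of the Cayley graph. -/
abbrev CSub (ι : X → G) : Type (max u v) := {A : Sub ι // A.IsConnected}

/-- The image `gΔ` of a connected subgraph `Δ` under the left action of `g`. -/
def CSub.translate {ι : X → G} (g : G) (A : CSub ι) : CSub ι := ⟨A.1.translate g, A.2.translate g⟩

/-! ### The categories of closure operators -/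

/-- A `G`-invariant, finitary closure operator on the poset of connected subgraphs. -/
structure IsInvFinitaryC {ι : X → G} (c : ClosureOperator (CSub ι)) : Prop where
  invariant : ∀ (g : G) (A : CSub ι), c (A.translate g) = (c A).translate g
  finitary_verts : ∀ A : CSub ι,
    (c A).1.verts = ⋃ F ∈ {F : CSub ι | F ≤ A ∧ F.1.IsFinite}, (c F).1.verts
  finitary_edges : ∀ A : CSub ι,
    (c A).1.edges = ⋃ F ∈ {F : CSub ι | F ≤ A ∧ F.1.IsFinite}, (c F).1.edges

/-- A `G`-invariant, finitary closure operator on the poset of all subgraphs, for which the empty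
subgraph is closed. -/
structure IsInvFinitaryS {ι : X → G} (c : ClosureOperator (Sub ι)) : Prop where
  invariant : ∀ (g : G) (A : Sub ι), c (A.translate g) = (c A).translate g
  finitary_verts : ∀ A : Sub ι,
    (c A).verts = ⋃ F ∈ {F : Sub ι | F ≤ A ∧ F.IsFinite}, (c F).verts
  finitary_edges : ∀ A : Sub ι,
    (c A).edges = ⋃ F ∈ {F : Sub ι | F ≤ A ∧ F.IsFinite}, (c F).edges
  closed_empty : c (Sub.empty ι) = Sub.empty ι

/-- The `G`-invariant, finitary closure operators on connected subgraphs. -/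
def ClosureC (ι : X → G) : Type (max u v) := {c : ClosureOperator (CSub ι) // IsInvFinitaryC c}

/-- The `G`-invariant, finitary closure operators on all subgraphs fixing the empty subgraph. -/
def ClosureS (ι : X → G) : Type (max u v) := {c : ClosureOperator (Sub ι) // IsInvFinitaryS c}

/-- There is a (unique) morphism from `c` to `c'` iff `Δ^c ⊆ Δ^c'` for every connected subgraph
`Δ`. -/
instance (ι : X → G) : Preorder (ClosureC ι) where
  le c c' := ∀ A : CSub ι, c.1 A ≤ c'.1 A
  le_refl _ _ := le_rfl
  le_trans _ _ _ h k A := (h A).trans (k A)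

/-- There is a (unique) morphism from `c` to `c'` iff `Δ^c ⊆ Δ^c'` for every subgraph `Δ`. -/
instance (ι : X → G) : Preorder (ClosureS ι) where
  le c c' := ∀ A : Sub ι, c.1 A ≤ c'.1 A
  le_refl _ _ := le_rfl
  le_trans _ _ _ h k A := (h A).trans (k A)

end Cayley

/-!
A closure operator `c` gives an inverse monoid whose elements are the pairs of the closure of a walk
in the Cayley graph from `1` to some `g`, and `g` itself; the product concatenates walks.
Conversely, in an inverse monoid `S` with an idempotent pure homomorphism to `G`, the Schützenberger
graph of an idempotent `e` is the subgraph spanned by the images of the elements `𝓡`-related to `e`.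
For a finite subgraph `F` traversed by a walk from `1` there is a largest idempotent whose
Schützenberger graph contains `F`; this graph is the closure of `F`, and the closures of all other
subgraphs follow because `c` is invariant and finitary.

Both parts are instances of one construction, for a subgroup `M` of `G`: in addition to following
edges, a walk may jump from `v` to `v * m` for `m ∈ M`. For `M = ⊥` these are the usual walks. For
`M = ⊤` every nonempty subgraph becomes connected, and the jump from `1` to `g` gives the greatest
element of the `σ`-class over `g`.
-/

namespace InverseMonoid

section Inverse

variable {S : Type u} [InverseMonoid S]

theorem inv_eq_self {e : S} (he : IsIdempotentElem e) : e⁻¹ = e :=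
  (inv_unique e e (by rw [he, he]) (by rw [he, he])).symm

instance : InvolutiveInv S where
  inv_inv a := (inv_unique a⁻¹ a (inv_mul_inv a) (mul_inv_mul a)).symm

theorem isIdempotentElem_mul {e f : S} (he : IsIdempotentElem e) (hf : IsIdempotentElem f) :
    IsIdempotentElem (e * f) := by
  have conj_inv : f * (e * f)⁻¹ * e = (e * f)⁻¹ := by
    apply inv_unique
    · calc e * f * (f * (e * f)⁻¹ * e) * (e * f)
          = e * (f * f) * (e * f)⁻¹ * (e * e * f) := by simp only [mul_assoc]
        _ = e * f := by rw [he, hf, mul_inv_mul]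
    · calc f * (e * f)⁻¹ * e * (e * f) * (f * (e * f)⁻¹ * e)
          = f * ((e * f)⁻¹ * (e * e * (f * f)) * (e * f)⁻¹) * e := by simp only [mul_assoc]
        _ = f * (e * f)⁻¹ * e := by rw [he, hf, inv_mul_inv]
  have inv_idem : IsIdempotentElem (e * f)⁻¹ :=
    calc (e * f)⁻¹ * (e * f)⁻¹ = f * (e * f)⁻¹ * e * (f * (e * f)⁻¹ * e) := by rw [conj_inv]
      _ = f * ((e * f)⁻¹ * (e * f) * (e * f)⁻¹) * e := by simp only [mul_assoc]
      _ = (e * f)⁻¹ := by rw [inv_mul_inv, conj_inv]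
  rwa [← inv_inv (e * f), inv_eq_self inv_idem]

theorem idem_comm {e f : S} (he : IsIdempotentElem e) (hf : IsIdempotentElem f) :
    e * f = f * e := by
  have hef := isIdempotentElem_mul he hf
  have hfe := isIdempotentElem_mul hf he
  have : f * e = (e * f)⁻¹ := by
    apply inv_unique
    · calc e * f * (f * e) * (e * f) = e * (f * f) * (e * e) * f := by simp only [mul_assoc]
        _ = e * f * (e * f) := by rw [he, hf]; simp only [mul_assoc]
        _ = e * f := hef
    · calc f * e * (e * f) * (f * e) = f * (e * e) * (f * f) * e := by simp only [mul_assoc]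
        _ = f * e * (f * e) := by rw [he, hf]; simp only [mul_assoc]
        _ = f * e := hfe
  rw [this, inv_eq_self hef]

/-- The domain `s * s⁻¹` of `s`. The natural order of idempotents is written `e * f = e`. -/
def dom (s : S) : S := s * s⁻¹

theorem isIdempotentElem_dom (s : S) : IsIdempotentElem (dom s) := by
  rw [IsIdempotentElem, dom, ← mul_assoc, mul_inv_mul]

theorem dom_mul_self (s : S) : dom s * s = s := mul_inv_mul s

theorem dom_inv (s : S) : dom s⁻¹ = s⁻¹ * s := by rw [dom, inv_inv]

theorem dom_of_isIdempotentElem {e : S} (he : IsIdempotentElem e) : dom e = e := by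
  rw [dom, inv_eq_self he, he]

theorem isIdempotentElem_inv_mul (s : S) : IsIdempotentElem (s⁻¹ * s) :=
  dom_inv s ▸ isIdempotentElem_dom s⁻¹

instance : DivisionMonoid S where
  mul_inv_rev a b := by
    have comm : b * b⁻¹ * (a⁻¹ * a) = a⁻¹ * a * (b * b⁻¹) :=
      idem_comm (isIdempotentElem_dom b) (isIdempotentElem_inv_mul a)
    symm
    apply inv_unique
    · calc a * b * (b⁻¹ * a⁻¹) * (a * b) = a * (b * b⁻¹ * (a⁻¹ * a)) * b := by
            simp only [mul_assoc]
        _ = (a * a⁻¹ * a) * (b * b⁻¹ * b) := by rw [comm]; simp only [mul_assoc]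
        _ = a * b := by rw [mul_inv_mul, mul_inv_mul]
    · calc b⁻¹ * a⁻¹ * (a * b) * (b⁻¹ * a⁻¹) = b⁻¹ * (a⁻¹ * a * (b * b⁻¹)) * a⁻¹ := by
            simp only [mul_assoc]
        _ = (b⁻¹ * b * b⁻¹) * (a⁻¹ * a * a⁻¹) := by rw [← comm]; simp only [mul_assoc]
        _ = b⁻¹ * a⁻¹ := by rw [inv_mul_inv, inv_mul_inv]
  inv_eq_of_mul a b h :=
    (inv_unique a b (by rw [h, one_mul]) (by rw [mul_assoc, h, mul_one])).symm

theorem dom_one : dom (1 : S) = 1 := dom_of_isIdempotentElem .one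

theorem dom_mul (s t : S) : dom (s * t) = s * dom t * s⁻¹ := by
  simp only [dom, mul_inv_rev, mul_assoc]

theorem dom_mul_of_isIdempotentElem {e : S} (he : IsIdempotentElem e) (s : S) :
    dom (e * s) = e * dom s := by
  rw [dom_mul, inv_eq_self he, idem_comm he (isIdempotentElem_dom s), mul_assoc, he]

theorem dom_mul_mul_dom (s t : S) : dom (s * t) * dom s = dom (s * t) := by
  rw [dom_mul, dom, dom, mul_assoc, ← mul_assoc s⁻¹ s s⁻¹, inv_mul_inv]

theorem mul_dom_of_mul_dom_mul {e s t : S} (h : e * dom (s * t) = e) : e * dom s = e := by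
  rw [← h, mul_assoc, dom_mul_mul_dom]

theorem isIdempotentElem_conj {e s : S} (he : IsIdempotentElem e) (h : e * dom s = e) :
    IsIdempotentElem (s⁻¹ * e * s) :=
  calc (s⁻¹ * e * s) * (s⁻¹ * e * s) = s⁻¹ * (e * dom s * e) * s := by
        simp only [dom, mul_assoc]
    _ = s⁻¹ * e * s := by rw [h, he]

theorem conj_mul_dom_inv (e s : S) : s⁻¹ * e * s * dom s⁻¹ = s⁻¹ * e * s := by
  rw [dom_inv, ← mul_assoc, mul_assoc (s⁻¹ * e), mul_assoc (s⁻¹ * e), mul_inv_mul]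

theorem conj_inv_conj {e s : S} (he : IsIdempotentElem e) (h : e * dom s = e) :
    s⁻¹⁻¹ * (s⁻¹ * e * s) * s⁻¹ = e := by
  calc s⁻¹⁻¹ * (s⁻¹ * e * s) * s⁻¹ = dom s * e * dom s := by
        rw [inv_inv]; simp only [dom, mul_assoc]
    _ = e := by rw [← idem_comm he (isIdempotentElem_dom s), h, h]

theorem mul_dom_mul_eq_iff {e s t : S} (he : IsIdempotentElem e) :
    e * dom (s * t) = e ↔ e * dom s = e ∧ s⁻¹ * e * s * dom t = s⁻¹ * e * s := by
  constructor
  · intro h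
    refine ⟨mul_dom_of_mul_dom_mul h, ?_⟩
    calc s⁻¹ * e * s * dom t = s⁻¹ * e * s * (s⁻¹ * s * dom t) := by
          rw [← mul_assoc, ← dom_inv, conj_mul_dom_inv]
      _ = s⁻¹ * e * s * (dom t * (s⁻¹ * s)) := by
          rw [idem_comm (isIdempotentElem_inv_mul s) (isIdempotentElem_dom t)]
      _ = s⁻¹ * (e * dom (s * t)) * s := by rw [dom_mul]; simp only [mul_assoc]
      _ = s⁻¹ * e * s := by rw [h]
  · rintro ⟨hs, ht⟩
    have absorb : e * s * (s⁻¹ * e * s) = e * s :=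
      calc e * s * (s⁻¹ * e * s) = e * dom s * e * s := by simp only [dom, mul_assoc]
        _ = e * s := by rw [hs, he]
    calc e * dom (s * t) = e * s * dom t * s⁻¹ := by rw [dom_mul]; simp only [mul_assoc]
      _ = e * s * (s⁻¹ * e * s * dom t) * s⁻¹ := by rw [← mul_assoc (e * s), absorb]
      _ = e * dom s := by rw [ht, absorb, dom, mul_assoc]
      _ = e := hs

theorem NatLE.dom_mul_dom {a b : S} (h : NatLE a b) : dom a * dom b = dom a := by
  have comm := idem_comm (isIdempotentElem_dom a) (isIdempotentElem_dom b)
  have absorb : dom b * a = a :=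
    calc dom b * a = dom a * (dom b * b) := by
          rw [← mul_assoc, comm, mul_assoc]; exact congrArg _ h
      _ = a := by rw [dom_mul_self]; exact h.symm
  rw [comm]
  nth_rw 2 [dom]
  rw [← mul_assoc, absorb, dom]

theorem NatLE.antisymm {a b : S} (hab : NatLE a b) (hba : NatLE b a) : a = b := by
  have hdom : dom a = dom b := by
    rw [← hab.dom_mul_dom, idem_comm (isIdempotentElem_dom a) (isIdempotentElem_dom b),
      hba.dom_mul_dom]
  rw [hab, ← dom, hdom, dom_mul_self]

end Inverse

section Hom

variable {S T : Type*} [InverseMonoid S] [InverseMonoid T]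

theorem map_inv (φ : S →* T) (a : S) : φ a⁻¹ = (φ a)⁻¹ :=
  inv_unique _ _ (by simp only [← map_mul, mul_inv_mul]) (by simp only [← map_mul, inv_mul_inv])

theorem NatLE.map {a b : S} (h : NatLE a b) (φ : S →* T) : NatLE (φ a) (φ b) :=
  (congrArg φ h).trans (by simp only [map_mul, map_inv])

end Hom

section GroupImage

variable {S : Type u} [InverseMonoid S] {G : Type v} [Group G]

theorem map_inv_of_group (π : S →* G) (s : S) : π s⁻¹ = (π s)⁻¹ := by
  have h := congrArg π (mul_inv_mul s)
  rw [map_mul, map_mul] at h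
  exact eq_inv_of_mul_eq_one_right (mul_eq_right.1 h)

theorem sigma_one {e : S} (he : IsIdempotentElem e) : sigma S e 1 := fun c hc => by
  simpa only [inv_eq_self he, he.eq] using (hc e).1

theorem map_eq_of_sigma (π : S →* G) {a b : S} (h : sigma S a b) : π a = π b :=
  h (Con.ker π) fun s => by simp [Con.ker_rel, map_inv_of_group]

theorem exists_mem_map_eq {X : Type*} {ι : X → G} (hι : Subgroup.closure (Set.range ι) = ⊤)
    {gen : X → S} {π : S →* G} (hgen : ∀ x, π (gen x) = ι x) {T : Set S} (gen_mem : ∀ x, gen x ∈ T)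
    (one_mem : 1 ∈ T) (mul_mem : ∀ a ∈ T, ∀ b ∈ T, a * b ∈ T) (inv_mem : ∀ a ∈ T, a⁻¹ ∈ T)
    (g : G) : ∃ t ∈ T, π t = g := by
  induction (hι ▸ Subgroup.mem_top g : g ∈ Subgroup.closure (Set.range ι)) using
    Subgroup.closure_induction with
  | mem _ hx =>
    obtain ⟨x, rfl⟩ := hx
    exact ⟨gen x, gen_mem x, hgen x⟩
  | one => exact ⟨1, one_mem, map_one π⟩
  | mul _ _ _ _ iha ihb =>
    obtain ⟨⟨a, ha, rfl⟩, b, hb, rfl⟩ := iha, ihb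
    exact ⟨a * b, mul_mem a ha b hb, map_mul π a b⟩
  | inv _ _ iha =>
    obtain ⟨a, ha, rfl⟩ := iha
    exact ⟨a⁻¹, inv_mem a ha, map_inv_of_group π a⟩

/-- A homomorphism to a group is idempotent pure if only idempotents are mapped to `1`. -/
def IdempotentPure (π : S →* G) : Prop := ∀ s, π s = 1 → IsIdempotentElem s

/-- `m` is the greatest element of the fibre of `π` through `m`. -/
def IsFibreMax (π : S →* G) (m : S) : Prop := ∀ t, π t = π m → NatLE t m

theorem IsFibreMax.eq {π : S →* G} {m n : S} (hm : IsFibreMax π m) (hn : IsFibreMax π n)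
    (h : π m = π n) : m = n :=
  (hn m h).antisymm (hm n h.symm)

theorem IsFibreMax.map_mulEquiv {T : Type*} [InverseMonoid T] {π : S →* G} {ρ : T →* G} {m : S}
    (hm : IsFibreMax π m) (e : S ≃* T) (he : ∀ s, ρ (e s) = π s) : IsFibreMax ρ (e m) := by
  intro t ht
  obtain ⟨s, rfl⟩ := e.surjective t
  exact (hm s (by rw [← he, ht, he])).map e.toMonoidHom

namespace IdempotentPure

variable {π : S →* G} (hπ : IdempotentPure π)

include hπ

theorem map_eq_iff_sigma {a b : S} : π a = π b ↔ sigma S a b := by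
  refine ⟨fun h => ?_, map_eq_of_sigma π⟩
  have hab : IsIdempotentElem (a * b⁻¹) := hπ _ (by simp [map_inv_of_group, h])
  have ha := (sigma S).mul ((sigma S).refl a) (sigma_one (isIdempotentElem_inv_mul b))
  have hb := (sigma S).mul (sigma_one hab) ((sigma S).refl b)
  rw [mul_one, ← mul_assoc] at ha
  rw [one_mul] at hb
  exact (sigma S).trans ((sigma S).symm ha) hb

theorem isGreatestGroupImage (hsurj : Function.Surjective π) : IsGreatestGroupImage π :=
  ⟨hsurj, fun _ _ => hπ.map_eq_iff_sigma⟩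

theorem isEUnitary : IsEUnitary S := fun s =>
  ⟨fun h => hπ s (by rw [map_eq_of_sigma π h, map_one]), sigma_one⟩

theorem eq_of_dom_eq {s t : S} (hdom : dom s = dom t) (hst : π s = π t) : s = t := by
  have he : IsIdempotentElem (s⁻¹ * t) := hπ _ (by simp [map_inv_of_group, hst])
  have ht : s * (s⁻¹ * t) = t := by rw [← mul_assoc, ← dom, hdom, dom_mul_self]
  have hs : t * (s⁻¹ * t) = s :=
    calc t * (s⁻¹ * t) = t * (s⁻¹ * t)⁻¹ := by rw [inv_eq_self he]
      _ = dom s * s := by rw [mul_inv_rev, inv_inv, hdom, dom, mul_assoc]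
      _ = s := dom_mul_self s
  calc s = s * (s⁻¹ * t) * (s⁻¹ * t) := by rw [ht, hs]
    _ = t := by rw [mul_assoc, he, ht]

theorem isFibreMax_one : IsFibreMax π 1 := fun t ht => by
  have he := hπ t (ht.trans (map_one π))
  rw [NatLE, mul_one, ← dom, dom_of_isIdempotentElem he]

end IdempotentPure

theorem IsEUnitary.idempotentPure (hS : IsEUnitary S) {π : S →* G}
    (hπ : IsGreatestGroupImage π) : IdempotentPure π := fun s hs =>
  (hS s).1 ((hπ.2 s 1).1 (hs.trans (map_one π).symm))

end GroupImage

end InverseMonoid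

namespace FInverseMonoid

open InverseMonoid

theorem isEUnitary (S : Type*) [FInverseMonoid S] : IsEUnitary S := by
  refine fun s => ⟨fun hs => ?_, sigma_one⟩
  have max_one : maxElt (1 : S) = 1 := by
    have h : (1 : S) = 1 * 1⁻¹ * maxElt 1 := le_maxElt 1 1 ((sigma S).refl 1)
    exact (h.trans (by rw [inv_one, one_mul, one_mul])).symm
  have h : s = s * s⁻¹ * 1 := max_one ▸ le_maxElt 1 s hs
  rw [h, mul_one]
  exact isIdempotentElem_dom s

section GroupImage

variable {S : Type*} [FInverseMonoid S] {G : Type*} [Group G] {π : S →* G}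

theorem map_maxElt (π : S →* G) (a : S) : π (maxElt a) = π a :=
  map_eq_of_sigma π (maxElt_sigma a)

theorem isFibreMax_maxElt (hπ : IsGreatestGroupImage π) (a : S) : IsFibreMax π (maxElt a) :=
  fun t ht => le_maxElt a t ((hπ.2 t a).1 (ht.trans (map_maxElt π a)))

theorem eq_maxElt (hπ : IsGreatestGroupImage π) {m a : S} (hm : IsFibreMax π m)
    (h : π m = π a) : m = maxElt a :=
  hm.eq (isFibreMax_maxElt hπ a) (h.trans (map_maxElt π a).symm)

end GroupImage

end FInverseMonoid

namespace Cayley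

variable {X : Type u} {G : Type v} [Group G] {ι : X → G}

theorem Edge.inverse_inverse (e : Edge ι) : e.inverse.inverse = e := by
  obtain ⟨g, x, b⟩ := e
  cases b <;> simp [inverse, target, letterVal]

theorem Edge.target_inverse (e : Edge ι) : e.inverse.target = e.source := by
  obtain ⟨g, x, b⟩ := e
  cases b <;> simp [inverse, target, source, letterVal]

namespace Sub

instance : SupSet (Sub ι) where
  sSup D :=
    { verts := ⋃ A ∈ D, A.verts
      edges := ⋃ A ∈ D, A.edges
      source_mem := fun e he => by
        obtain ⟨A, hA, he⟩ := Set.mem_iUnion₂.1 he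
        exact Set.mem_biUnion hA (A.source_mem e he)
      target_mem := fun e he => by
        obtain ⟨A, hA, he⟩ := Set.mem_iUnion₂.1 he
        exact Set.mem_biUnion hA (A.target_mem e he)
      inverse_mem := fun e he => by
        obtain ⟨A, hA, he⟩ := Set.mem_iUnion₂.1 he
        exact Set.mem_biUnion hA (A.inverse_mem e he) }

instance : CompleteLattice (Sub ι) :=
  completeLatticeOfSup (Sub ι) fun _ =>
    ⟨fun _ hA => ⟨Set.subset_biUnion_of_mem hA, Set.subset_biUnion_of_mem hA⟩,
      fun _ hC => ⟨Set.iUnion₂_subset fun _ hA => (hC hA).1,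
        Set.iUnion₂_subset fun _ hA => (hC hA).2⟩⟩

theorem verts_sSup (D : Set (Sub ι)) : (sSup D).verts = ⋃ A ∈ D, A.verts := rfl

theorem edges_sSup (D : Set (Sub ι)) : (sSup D).edges = ⋃ A ∈ D, A.edges := rfl

theorem verts_sup (A B : Sub ι) : (A ⊔ B).verts = A.verts ∪ B.verts := by
  rw [← sSup_pair, verts_sSup, Set.biUnion_pair]

theorem edges_sup (A B : Sub ι) : (A ⊔ B).edges = A.edges ∪ B.edges := by
  rw [← sSup_pair, edges_sSup, Set.biUnion_pair]

theorem empty_eq_bot : empty ι = ⊥ :=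
  eq_bot_iff.2 ⟨Set.empty_subset _, Set.empty_subset _⟩

theorem nonempty_verts_iff {A : Sub ι} : A.verts.Nonempty ↔ A ≠ ⊥ := by
  rw [← empty_eq_bot, ← not_iff_not, not_not, Set.not_nonempty_iff_eq_empty]
  refine ⟨fun hA => Sub.ext hA (Set.eq_empty_of_forall_notMem fun e he => ?_), fun hA => hA ▸ rfl⟩
  exact (hA ▸ A.source_mem e he : Edge.source e ∈ (∅ : Set G))

section Action

theorem mem_verts_translate {g v : G} {A : Sub ι} :
    v ∈ (A.translate g).verts ↔ g⁻¹ * v ∈ A.verts := by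
  refine ⟨?_, fun h => ⟨_, h, mul_inv_cancel_left g v⟩⟩
  rintro ⟨w, hw, rfl⟩
  rwa [inv_mul_cancel_left]

theorem mem_edges_translate {g : G} {e : Edge ι} {A : Sub ι} :
    e ∈ (A.translate g).edges ↔ e.translate g⁻¹ ∈ A.edges := by
  refine ⟨?_, fun h => ⟨_, h, by simp [Edge.translate]⟩⟩
  rintro ⟨e, he, rfl⟩
  simpa [Edge.translate] using he

instance : MulAction G (Sub ι) where
  smul := translate
  one_smul A := by
    apply Sub.ext <;> ext <;> simp [HSMul.hSMul, mem_verts_translate, mem_edges_translate,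
      Edge.translate]
  mul_smul g h A := by
    apply Sub.ext <;> ext <;> simp [HSMul.hSMul, mem_verts_translate, mem_edges_translate,
      Edge.translate, mul_assoc]

theorem mem_verts_smul {g v : G} {A : Sub ι} : v ∈ (g • A).verts ↔ g⁻¹ * v ∈ A.verts :=
  mem_verts_translate

theorem mem_edges_smul {g : G} {e : Edge ι} {A : Sub ι} :
    e ∈ (g • A).edges ↔ e.translate g⁻¹ ∈ A.edges :=
  mem_edges_translate

theorem mul_mem_verts_smul {g v : G} {A : Sub ι} : g * v ∈ (g • A).verts ↔ v ∈ A.verts := by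
  rw [mem_verts_smul, inv_mul_cancel_left]

theorem smul_mono (g : G) {A B : Sub ι} (h : A ≤ B) : g • A ≤ g • B :=
  ⟨Set.image_mono h.1, Set.image_mono h.2⟩

/-- Left translation by `g`, as an automorphism of the lattice of subgraphs. -/
def smulIso (g : G) : Sub ι ≃o Sub ι where
  toEquiv := MulAction.toPerm g
  map_rel_iff' {A B} :=
    ⟨fun h => by simpa only [MulAction.toPerm_apply, inv_smul_smul] using smul_mono g⁻¹ h,
      smul_mono g⟩

theorem smul_le_smul_iff {g : G} {A B : Sub ι} : g • A ≤ g • B ↔ A ≤ B :=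
  (smulIso g).le_iff_le

theorem smul_le_iff {g : G} {A B : Sub ι} : g • A ≤ B ↔ A ≤ g⁻¹ • B := by
  rw [← smul_le_smul_iff (g := g) (B := g⁻¹ • B), smul_inv_smul]

theorem smul_sup (g : G) (A B : Sub ι) : g • (A ⊔ B) = g • A ⊔ g • B :=
  (smulIso g).map_sup A B

theorem smul_biSup (g : G) (D : Set (Sub ι)) (f : Sub ι → Sub ι) :
    g • ⨆ A ∈ D, f A = ⨆ A ∈ D, g • f A :=
  ((smulIso g).map_iSup _).trans (iSup_congr fun _ => (smulIso g).map_iSup _)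

end Action

section Finite

theorem IsFinite.smul {A : Sub ι} (h : A.IsFinite) (g : G) : (g • A).IsFinite :=
  ⟨h.1.image _, h.2.image _⟩

theorem IsFinite.sup {A B : Sub ι} (hA : A.IsFinite) (hB : B.IsFinite) : (A ⊔ B).IsFinite :=
  ⟨verts_sup A B ▸ hA.1.union hB.1, edges_sup A B ▸ hA.2.union hB.2⟩

theorem IsFinite.exists_le_of_directedOn {F : Sub ι} (hF : F.IsFinite) {D : Set (Sub ι)}
    (hne : D.Nonempty) (hD : DirectedOn (· ≤ ·) D) (h : F ≤ sSup D) : ∃ A ∈ D, F ≤ A := by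
  obtain ⟨_, ⟨A, hA, rfl⟩, hFA⟩ := DirectedOn.exists_mem_subset_of_finite_of_subset_sUnion
    (hne.image verts) (directedOn_image.2 (hD.mono fun _ _ h => h.1)) hF.1
    (by rw [Set.sUnion_image]; exact h.1)
  obtain ⟨_, ⟨B, hB, rfl⟩, hFB⟩ := DirectedOn.exists_mem_subset_of_finite_of_subset_sUnion
    (hne.image edges) (directedOn_image.2 (hD.mono fun _ _ h => h.2)) hF.2
    (by rw [Set.sUnion_image]; exact h.2)
  obtain ⟨C, hC, hAC, hBC⟩ := hD A hA B hB
  exact ⟨C, hC, hFA.trans hAC.1, hFB.trans hBC.2⟩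

end Finite

section Atoms

/-- The edgeless subgraph with the vertices `v` and `w`. -/
def pairSub (ι : X → G) (v w : G) : Sub ι where
  verts := {v, w}
  edges := ∅
  source_mem _ h := h.elim
  target_mem _ h := h.elim
  inverse_mem _ h := h.elim

/-- The subgraph consisting of an edge, its inverse and its endpoints. -/
def edgeSub (e : Edge ι) : Sub ι where
  verts := {e.source, e.target}
  edges := {e, e.inverse}
  source_mem := by
    rintro _ (rfl | rfl)
    exacts [Or.inl rfl, Or.inr rfl]
  target_mem := by
    rintro _ (rfl | rfl)
    exacts [Or.inr rfl, Or.inl e.target_inverse]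
  inverse_mem := by
    rintro _ (rfl | rfl)
    exacts [Or.inr rfl, Or.inl e.inverse_inverse]

theorem pairSub_le_iff {v w : G} {A : Sub ι} : pairSub ι v w ≤ A ↔ v ∈ A.verts ∧ w ∈ A.verts :=
  ⟨fun h => ⟨h.1 (Or.inl rfl), h.1 (Or.inr rfl)⟩,
    fun ⟨hv, hw⟩ => ⟨Set.pair_subset hv hw, Set.empty_subset _⟩⟩

theorem edgeSub_le_iff {e : Edge ι} {A : Sub ι} : edgeSub e ≤ A ↔ e ∈ A.edges :=
  ⟨fun h => h.2 (Or.inl rfl), fun h =>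
    ⟨Set.pair_subset (A.source_mem e h) (A.target_mem e h), Set.pair_subset h (A.inverse_mem e h)⟩⟩

theorem le_iff_pairSub_edgeSub {A B : Sub ι} :
    A ≤ B ↔ (∀ v ∈ A.verts, pairSub ι v v ≤ B) ∧ ∀ e ∈ A.edges, edgeSub e ≤ B := by
  simp only [pairSub_le_iff, and_self, edgeSub_le_iff]
  rfl

theorem smul_pairSub (g v w : G) : g • pairSub ι v w = pairSub ι (g * v) (g * w) :=
  eq_of_forall_ge_iff fun A => by
    simp only [smul_le_iff, pairSub_le_iff, mem_verts_smul, _root_.inv_inv]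

theorem smul_edgeSub (g : G) (e : Edge ι) : g • edgeSub e = edgeSub (e.translate g) :=
  eq_of_forall_ge_iff fun A => by
    simp only [smul_le_iff, edgeSub_le_iff, mem_edges_smul, _root_.inv_inv]

theorem pairSub_comm (v w : G) : pairSub ι v w = pairSub ι w v :=
  eq_of_forall_ge_iff fun A => by simp only [pairSub_le_iff, and_comm]

theorem edgeSub_inverse (e : Edge ι) : edgeSub e.inverse = edgeSub e :=
  eq_of_forall_ge_iff fun A => by
    simp only [edgeSub_le_iff]
    exact ⟨fun h => e.inverse_inverse ▸ A.inverse_mem _ h, A.inverse_mem e⟩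

theorem isFinite_pairSub (v w : G) : (pairSub ι v w).IsFinite :=
  ⟨Set.toFinite {v, w}, Set.finite_empty⟩

theorem isFinite_edgeSub (e : Edge ι) : (edgeSub e).IsFinite :=
  ⟨Set.toFinite {e.source, e.target}, Set.toFinite {e, e.inverse}⟩

end Atoms

end Sub

end Cayley

namespace Cayley

namespace Sub

variable {X : Type u} {G : Type v} [Group G] {ι : X → G} {M : Subgroup G}

/-- `IsTrace M A g`: the subgraph `A` is traversed by a walk from `1` to `g`, each step of which
either follows an edge or jumps from a vertex `v` to `v * m` for some `m ∈ M`. -/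
inductive IsTrace (M : Subgroup G) : Sub ι → G → Prop
  | jump {g : G} (hg : g ∈ M) : IsTrace M (pairSub ι 1 g) g
  | letter (a : X × Bool) : IsTrace M (edgeSub (1, a)) (letterVal ι a)
  | mul {A B : Sub ι} {g h : G} :
      IsTrace M A g → IsTrace M B h → IsTrace M (A ⊔ g • B) (g * h)

/-- The vertices `v` and `w` are joined by a walk within `A` with jumps in `M`. -/
def Joined (M : Subgroup G) (A : Sub ι) (v w : G) : Prop :=
  ∃ W : Sub ι, W.IsTrace M (v⁻¹ * w) ∧ v • W ≤ A

/-- Connectedness when jumps by elements of `M` are allowed. For `M = ⊥` this is connectedness, and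
for `M = ⊤` every nonempty subgraph qualifies: the two parts of the theorem are these two cases. -/
def IsConnectedMod (M : Subgroup G) (A : Sub ι) : Prop :=
  A.verts.Nonempty ∧ ∀ v ∈ A.verts, ∀ w ∈ A.verts, A.Joined M v w

namespace IsTrace

variable {A B : Sub ι} {g h : G}

theorem one : (pairSub ι 1 1).IsTrace M 1 := .jump M.one_mem

theorem one_mem (hA : A.IsTrace M g) : 1 ∈ A.verts := by
  induction hA with
  | jump | letter => exact Or.inl rfl
  | mul _ _ ih =>
    rw [verts_sup]
    exact Or.inl ih

theorem mem (hA : A.IsTrace M g) : g ∈ A.verts := by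
  induction hA with
  | jump => exact Or.inr rfl
  | letter a => exact Or.inr (one_mul _).symm
  | mul _ _ _ ih =>
    rw [verts_sup]
    exact Or.inr (mul_mem_verts_smul.2 ih)

theorem isFinite (hA : A.IsTrace M g) : A.IsFinite := by
  induction hA with
  | jump => exact isFinite_pairSub ..
  | letter => exact isFinite_edgeSub _
  | mul _ _ ihA ihB => exact ihA.sup (ihB.smul _)

theorem inv (hA : A.IsTrace M g) : (g⁻¹ • A).IsTrace M g⁻¹ := by
  induction hA with
  | jump hg =>
    rw [smul_pairSub, inv_mul_cancel, mul_one, pairSub_comm]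
    exact jump (M.inv_mem hg)
  | letter a =>
    obtain ⟨x, b⟩ := a
    have hval : (letterVal ι (x, b))⁻¹ = letterVal ι (x, !b) := by cases b <;> simp [letterVal]
    have hinv : Edge.translate (letterVal ι (x, b))⁻¹ (1, (x, b)) =
        (Edge.inverse (1, (x, !b)) : Edge ι) := by
      simp [Edge.translate, Edge.inverse, Edge.target, hval]
    rw [smul_edgeSub, hinv, edgeSub_inverse, hval]
    exact letter (x, !b)
  | @mul A B g h _ _ ihA ihB =>
    rw [smul_sup, smul_smul, mul_inv_rev, inv_mul_cancel_right, mul_smul, sup_comm]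
    exact ihB.mul ihA

end IsTrace

namespace Joined

variable {A B : Sub ι} {v w x : G}

theorem of_isTrace (h : A.IsTrace M v) : A.Joined M 1 v :=
  ⟨A, by simpa using h, (one_smul G A).le⟩

theorem refl (hv : v ∈ A.verts) : A.Joined M v v :=
  ⟨pairSub ι 1 1, by simpa using .one, by simpa [smul_pairSub, pairSub_le_iff] using hv⟩

theorem symm (h : A.Joined M v w) : A.Joined M w v := by
  obtain ⟨W, hW, hle⟩ := h
  refine ⟨_, by simpa using hW.inv, ?_⟩
  rwa [smul_smul, mul_inv_cancel_left]

theorem trans (h : A.Joined M v w) (k : A.Joined M w x) : A.Joined M v x := by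
  obtain ⟨V, hV, hVA⟩ := h
  obtain ⟨W, hW, hWA⟩ := k
  refine ⟨_, by simpa [mul_assoc] using hV.mul hW, ?_⟩
  rw [smul_sup, smul_smul, mul_inv_cancel_left]
  exact sup_le hVA hWA

theorem mono (hAB : A ≤ B) (h : A.Joined M v w) : B.Joined M v w :=
  h.imp fun _ hW => ⟨hW.1, hW.2.trans hAB⟩

theorem smul (g : G) (h : A.Joined M v w) : (g • A).Joined M (g * v) (g * w) := by
  obtain ⟨W, hW, hle⟩ := h
  exact ⟨W, by simpa [mul_assoc] using hW, mul_smul g v W ▸ smul_mono g hle⟩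

end Joined

namespace IsConnectedMod

variable {A B : Sub ι}

theorem of_joined {v : G} (hv : v ∈ A.verts) (h : ∀ w ∈ A.verts, A.Joined M v w) :
    A.IsConnectedMod M :=
  ⟨⟨v, hv⟩, fun x hx y hy => (h x hx).symm.trans (h y hy)⟩

theorem smul (hA : A.IsConnectedMod M) (g : G) : (g • A).IsConnectedMod M := by
  refine ⟨hA.1.image _, fun v hv w hw => ?_⟩
  rw [mem_verts_smul] at hv hw
  simpa using (hA.2 _ hv _ hw).smul g

theorem sup {v : G} (hA : A.IsConnectedMod M) (hB : B.IsConnectedMod M) (hvA : v ∈ A.verts)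
    (hvB : v ∈ B.verts) : (A ⊔ B).IsConnectedMod M := by
  have hv : v ∈ (A ⊔ B).verts := verts_sup A B ▸ Or.inl hvA
  refine of_joined hv fun w hw => ?_
  rw [verts_sup] at hw
  exact hw.elim (fun hw => (hA.2 v hvA w hw).mono le_sup_left)
    fun hw => (hB.2 v hvB w hw).mono le_sup_right

end IsConnectedMod

theorem isConnectedMod_pairSub (v : G) : (pairSub ι v v).IsConnectedMod M := by
  have key : ∀ w ∈ (pairSub ι v v).verts, w = v := fun w hw => hw.elim id id
  refine .of_joined (Or.inl rfl) fun w hw => ?_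
  rw [key w hw]
  exact .refl (Or.inl rfl)

theorem IsTrace.isConnectedMod {A : Sub ι} {g : G} (hA : A.IsTrace M g) :
    A.IsConnectedMod M := by
  have two_points : ∀ {A : Sub ι} {g : G}, A.IsTrace M g → A.verts = {1, g} →
      A.IsConnectedMod M := fun hA hv => .of_joined hA.one_mem fun w hw => by
    obtain rfl | rfl : w = 1 ∨ w = _ := hv ▸ hw
    exacts [.refl hw, .of_isTrace hA]
  induction hA with
  | jump hg => exact two_points (.jump hg) rfl
  | letter a => exact two_points (.letter a) (by simp [edgeSub, Edge.source, Edge.target])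
  | mul hA hB ihA ihB =>
    exact ihA.sup (ihB.smul _) hA.mem (by simpa [mem_verts_smul] using hB.one_mem)

theorem Joined.exists_closed_isTrace {A C : Sub ι} {v c : G} (hC : C.IsTrace M c) (hle : v • C ≤ A)
    (out : A.Joined M 1 v) (back : A.Joined M (v * c) 1) :
    ∃ W ≤ A, W.IsTrace M 1 ∧ v • C ≤ W := by
  obtain ⟨U, hU, hUA⟩ := out
  obtain ⟨V, hV, hVA⟩ := back
  simp only [inv_one, one_mul, one_smul, mul_one] at hU hUA hV
  exact ⟨_, sup_le (sup_le hUA hle) hVA, by simpa using (hU.mul hC).mul hV,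
    le_sup_right.trans le_sup_left⟩

/-- A connected subgraph is the directed union of the closed walks at `1` in it; being finite, it
is one of them. -/
theorem IsConnectedMod.isTrace_one {A : Sub ι} (hA : A.IsConnectedMod M) (hf : A.IsFinite)
    (h1 : 1 ∈ A.verts) : A.IsTrace M 1 := by
  have covered : ∀ {C : Sub ι} {v c : G}, C.IsTrace M c → v • C ≤ A →
      v • C ≤ sSup {W | W ≤ A ∧ W.IsTrace M 1} := fun {C v c} hC hle => by
    have hv : v ∈ A.verts := hle.1 (by simpa [mem_verts_smul] using hC.one_mem)
    have hvc : v * c ∈ A.verts := hle.1 (mul_mem_verts_smul.2 hC.mem)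
    obtain ⟨W, hWA, hW, hCW⟩ :=
      Joined.exists_closed_isTrace hC hle (hA.2 _ h1 _ hv) (hA.2 _ hvc _ h1)
    exact hCW.trans (le_sSup ⟨hWA, hW⟩)
  have exhausts : A ≤ sSup {W | W ≤ A ∧ W.IsTrace M 1} := by
    refine le_iff_pairSub_edgeSub.2 ⟨fun v hv => ?_, fun ⟨v, a⟩ he => ?_⟩
    · simpa [smul_pairSub] using covered (v := v) .one (by simpa [smul_pairSub, pairSub_le_iff])
    · simpa [smul_edgeSub, Edge.translate] using
        covered (v := v) (.letter a) (by simpa [smul_edgeSub, Edge.translate, edgeSub_le_iff])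
  have directed : DirectedOn (· ≤ ·) {W | W ≤ A ∧ W.IsTrace M 1} := fun V hV W hW =>
    ⟨V ⊔ W, ⟨sup_le hV.1 hW.1, by simpa using hV.2.mul hW.2⟩, le_sup_left, le_sup_right⟩
  have nonempty : {W | W ≤ A ∧ W.IsTrace M 1}.Nonempty :=
    ⟨pairSub ι 1 1, pairSub_le_iff.2 ⟨h1, h1⟩, .one⟩
  obtain ⟨W, ⟨hWA, hW⟩, hAW⟩ := hf.exists_le_of_directedOn nonempty directed exhausts
  rwa [le_antisymm hAW hWA]

theorem isTrace_iff {A : Sub ι} {g : G} :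
    A.IsTrace M g ↔ A.IsConnectedMod M ∧ A.IsFinite ∧ 1 ∈ A.verts ∧ g ∈ A.verts := by
  refine ⟨fun h => ⟨h.isConnectedMod, h.isFinite, h.one_mem, h.mem⟩, ?_⟩
  rintro ⟨hA, hf, h1, hg⟩
  obtain ⟨W, hW, hWA⟩ := hA.2 1 h1 g hg
  rw [one_smul] at hWA
  simpa [sup_eq_left.2 hWA] using (hA.isTrace_one hf h1).mul hW

theorem isConnectedMod_top {A : Sub ι} : A.IsConnectedMod ⊤ ↔ A.verts.Nonempty :=
  ⟨fun h => h.1, fun hA => ⟨hA, fun v hv w hw => ⟨_, .jump (Subgroup.mem_top _), by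
    simpa [smul_pairSub, pairSub_le_iff] using And.intro hv hw⟩⟩⟩

theorem Joined.reflTransGen {A : Sub ι} {v w : G} (h : A.Joined ⊥ v w) :
    Relation.ReflTransGen A.Step v w := by
  obtain ⟨W, hW, hle⟩ := h
  rw [← mul_inv_cancel_left v w]
  generalize v⁻¹ * w = g at hW
  induction hW generalizing v with
  | jump hg => rw [Subgroup.mem_bot.1 hg, mul_one]
  | letter a =>
    rw [smul_edgeSub, edgeSub_le_iff] at hle
    exact .single ⟨_, hle, mul_one v, congrArg (· * _) (mul_one v)⟩
  | mul _ _ ihA ihB =>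
    rw [smul_sup, smul_smul] at hle
    rw [← mul_assoc]
    exact (ihA (le_sup_left.trans hle)).trans (ihB (le_sup_right.trans hle))

theorem isConnectedMod_bot {A : Sub ι} : A.IsConnectedMod ⊥ ↔ A.IsConnected := by
  refine ⟨fun h => ⟨h.1, fun v hv w hw => (h.2 v hv w hw).reflTransGen⟩,
    fun h => ⟨h.1, fun v hv w hw => ?_⟩⟩
  have path := h.2 v hv w hw
  clear hw
  induction path with
  | refl => exact .refl hv
  | tail _ hs ih =>
    obtain ⟨⟨g, a⟩, he, rfl, rfl⟩ := hs
    refine ih.trans ⟨edgeSub (1, a), ?_, ?_⟩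
    · simpa [Edge.source, Edge.target] using .letter a
    · simpa [smul_edgeSub, Edge.translate, Edge.source, edgeSub_le_iff] using he

end Sub

end Cayley

namespace Cayley

variable {X : Type u} {G : Type v} [Group G] {ι : X → G} {M : Subgroup G}

namespace Sub

variable {A B F : Sub ι}

/-- The finite subgraphs of `A` that are connected up to jumps in `M`. -/
def finiteParts (M : Subgroup G) (A : Sub ι) : Set (Sub ι) :=
  {F | F ≤ A ∧ F.IsConnectedMod M ∧ F.IsFinite}

theorem finiteParts_mono (h : A ≤ B) : A.finiteParts M ⊆ B.finiteParts M :=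
  fun _ hF => ⟨hF.1.trans h, hF.2⟩

theorem self_mem_finiteParts (hc : F.IsConnectedMod M) (hf : F.IsFinite) : F ∈ F.finiteParts M :=
  ⟨le_rfl, hc, hf⟩

theorem finiteParts_smul (g : G) (A : Sub ι) :
    (g • A).finiteParts M = (g • ·) '' A.finiteParts M := by
  refine Set.Subset.antisymm (fun F hF => ⟨g⁻¹ • F, ?_, smul_inv_smul g F⟩) ?_
  · exact ⟨by rw [smul_le_iff, _root_.inv_inv]; exact hF.1, hF.2.1.smul _, hF.2.2.smul _⟩
  · rintro _ ⟨F, hF, rfl⟩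
    exact ⟨smul_mono g hF.1, hF.2.1.smul g, hF.2.2.smul g⟩

theorem le_of_forall_finiteParts (h : ∀ F ∈ A.finiteParts M, F ≤ B) : A ≤ B := by
  refine le_iff_pairSub_edgeSub.2 ⟨fun v hv => h _ ⟨pairSub_le_iff.2 ⟨hv, hv⟩, ?_⟩, fun e he =>
    h _ ⟨edgeSub_le_iff.2 he, ?_⟩⟩
  · exact ⟨isConnectedMod_pairSub v, isFinite_pairSub v v⟩
  · obtain ⟨v, a⟩ := e
    have : v • edgeSub (1, a) = (edgeSub (v, a) : Sub ι) := by simp [smul_edgeSub, Edge.translate]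
    exact ⟨this ▸ (IsTrace.letter a).isConnectedMod.smul v, isFinite_edgeSub _⟩

theorem IsConnectedMod.finiteParts_nonempty (hA : A.IsConnectedMod M) :
    (A.finiteParts M).Nonempty :=
  let ⟨v, hv⟩ := hA.1
  ⟨_, pairSub_le_iff.2 ⟨hv, hv⟩, isConnectedMod_pairSub v, isFinite_pairSub v v⟩

theorem IsConnectedMod.directedOn_finiteParts (hA : A.IsConnectedMod M) :
    DirectedOn (· ≤ ·) (A.finiteParts M) := by
  rintro E ⟨hEA, hE, hEf⟩ F ⟨hFA, hF, hFf⟩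
  obtain ⟨v, hv⟩ := hE.1
  obtain ⟨w, hw⟩ := hF.1
  obtain ⟨W, hW, hWA⟩ := hA.2 v (hEA.1 hv) w (hFA.1 hw)
  have hvW : v ∈ (v • W).verts := by simpa [mem_verts_smul] using hW.one_mem
  have hwW : w ∈ (v • W).verts := mem_verts_smul.2 hW.mem
  have hEW := hE.sup (hW.isConnectedMod.smul v) hv hvW
  refine ⟨E ⊔ v • W ⊔ F, ⟨sup_le (sup_le hEA hWA) hFA, ?_, (hEf.sup (hW.isFinite.smul v)).sup hFf⟩,
    le_sup_left.trans le_sup_left, le_sup_right⟩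
  exact hEW.sup hF (verts_sup E _ ▸ Or.inr hwW) hw

end Sub

/-- A `G`-invariant finitary closure operator on the subgraphs that are connected up to jumps in
`M`. To avoid subtypes, `cl` is defined on all subgraphs; there it is determined by its values on
finite connected subgraphs, and it need not be idempotent. -/
@[ext]
structure InvariantClosure (ι : X → G) (M : Subgroup G) where
  cl : Sub ι → Sub ι
  isConnectedMod_cl : ∀ A, A.IsConnectedMod M → (cl A).IsConnectedMod M
  le_cl : ∀ A, A ≤ cl A
  cl_cl_le : ∀ A, A.IsConnectedMod M → cl (cl A) ≤ cl A
  cl_smul : ∀ (g : G) (A : Sub ι), cl (g • A) = g • cl A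
  finitary : ∀ A, cl A = ⨆ F ∈ A.finiteParts M, cl F

namespace InvariantClosure

instance : PartialOrder (InvariantClosure ι M) :=
  PartialOrder.lift cl fun _ _ => InvariantClosure.ext

variable (c : InvariantClosure ι M) {A B F : Sub ι}

theorem cl_mono (h : A ≤ B) : c.cl A ≤ c.cl B := by
  rw [c.finitary A, c.finitary B]
  exact biSup_mono (Sub.finiteParts_mono h)

theorem cl_cl (hA : A.IsConnectedMod M) : c.cl (c.cl A) = c.cl A :=
  (c.cl_cl_le A hA).antisymm (c.le_cl _)

theorem cl_le_cl (hB : B.IsConnectedMod M) (h : A ≤ c.cl B) : c.cl A ≤ c.cl B :=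
  (c.cl_mono h).trans (c.cl_cl_le B hB)

theorem cl_sup_cl (h : (A ⊔ B).IsConnectedMod M) : c.cl (c.cl A ⊔ c.cl B) = c.cl (A ⊔ B) :=
  (c.cl_le_cl h (sup_le (c.cl_mono le_sup_left) (c.cl_mono le_sup_right))).antisymm
    (c.cl_mono (sup_le_sup (c.le_cl A) (c.le_cl B)))

theorem cl_cl_of_le {c c' : InvariantClosure ι M} (h : c ≤ c') (hA : A.IsConnectedMod M) :
    c'.cl (c.cl A) = c'.cl A :=
  (c'.cl_le_cl hA (h A)).antisymm (c'.cl_mono (c.le_cl A))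

theorem le_of_forall_isTrace_one {c c' : InvariantClosure ι M}
    (h : ∀ F : Sub ι, F.IsTrace M 1 → c.cl F ≤ c'.cl F) : c ≤ c' := fun A => by
  rw [c.finitary A, c'.finitary A]
  refine iSup₂_mono fun F hF => ?_
  obtain ⟨v, hv⟩ := hF.2.1.1
  have h1 : 1 ∈ (v⁻¹ • F).verts := by simpa [Sub.mem_verts_smul] using hv
  have htrace := (hF.2.1.smul v⁻¹).isTrace_one (hF.2.2.smul v⁻¹) h1
  simpa only [cl_smul, Sub.smul_le_smul_iff] using h _ htrace

/-- A `G`-invariant family of subgraphs, connected up to jumps in `M`, that contains a least member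
above every finite subgraph connected up to jumps in `M`. The family itself need not be closed under
intersections. -/
structure IsClosureFamily (M : Subgroup G) (𝓕 : Set (Sub ι)) : Prop where
  isConnectedMod : ∀ C ∈ 𝓕, C.IsConnectedMod M
  smul_mem : ∀ (g : G), ∀ C ∈ 𝓕, g • C ∈ 𝓕
  exists_isLeast : ∀ F : Sub ι, F.IsConnectedMod M → F.IsFinite →
    ∃ C, IsLeast {C ∈ 𝓕 | F ≤ C} C

/-- The intersection of the members of `𝓕` above `F`. -/
def hull (𝓕 : Set (Sub ι)) (F : Sub ι) : Sub ι := sInf {C ∈ 𝓕 | F ≤ C}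

theorem hull_mono (𝓕 : Set (Sub ι)) (h : A ≤ B) : hull 𝓕 A ≤ hull 𝓕 B :=
  sInf_le_sInf fun _ hC => ⟨hC.1, h.trans hC.2⟩

theorem biSup_hull_eq (𝓕 : Set (Sub ι)) (hc : F.IsConnectedMod M) (hf : F.IsFinite) :
    ⨆ E ∈ F.finiteParts M, hull 𝓕 E = hull 𝓕 F :=
  (iSup₂_le fun _ hE => hull_mono 𝓕 hE.1).antisymm
    (le_biSup (hull 𝓕) (Sub.self_mem_finiteParts hc hf))

theorem exists_le_hull {𝓕 : Set (Sub ι)} (hA : A.IsConnectedMod M) (hf : F.IsFinite)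
    (hFA : F ≤ ⨆ E ∈ A.finiteParts M, hull 𝓕 E) : ∃ E ∈ A.finiteParts M, F ≤ hull 𝓕 E := by
  rw [← sSup_image] at hFA
  obtain ⟨_, ⟨E, hE, rfl⟩, hFE⟩ := hf.exists_le_of_directedOn (hA.finiteParts_nonempty.image _)
    (directedOn_image.2 (hA.directedOn_finiteParts.mono fun _ _ h => hull_mono 𝓕 h)) hFA
  exact ⟨E, hE, hFE⟩

namespace IsClosureFamily

variable {𝓕 : Set (Sub ι)} (h𝓕 : IsClosureFamily M 𝓕)

include h𝓕

theorem hull_mem (hc : F.IsConnectedMod M) (hf : F.IsFinite) : hull 𝓕 F ∈ 𝓕 :=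
  let ⟨_, hC⟩ := h𝓕.exists_isLeast F hc hf
  (hC.csInf_mem).1

theorem hull_smul (g : G) (F : Sub ι) : hull 𝓕 (g • F) = g • hull 𝓕 F := by
  have key : ∀ (g : G) (F : Sub ι), hull 𝓕 (g • F) ≤ g • hull 𝓕 F := fun g F => by
    rw [← inv_inv g, ← Sub.smul_le_iff, inv_inv]
    refine le_sInf fun C hC => ?_
    rw [Sub.smul_le_iff, inv_inv]
    exact sInf_le ⟨h𝓕.smul_mem g C hC.1, Sub.smul_mono g hC.2⟩
  refine (key g F).antisymm ?_
  rw [Sub.smul_le_iff]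
  simpa only [inv_smul_smul] using key g⁻¹ (g • F)

theorem isConnectedMod_biSup_hull (hA : A.IsConnectedMod M) :
    (⨆ E ∈ A.finiteParts M, hull 𝓕 E).IsConnectedMod M := by
  obtain ⟨E, hE⟩ := hA.finiteParts_nonempty
  obtain ⟨v, hv⟩ := (h𝓕.isConnectedMod _ (h𝓕.hull_mem hE.2.1 hE.2.2)).1
  refine ⟨⟨v, (le_biSup (hull 𝓕) hE).1 hv⟩, fun v hv w hw => ?_⟩
  obtain ⟨E, hE, hvw⟩ := exists_le_hull hA (Sub.isFinite_pairSub v w)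
    (Sub.pairSub_le_iff.2 ⟨hv, hw⟩)
  rw [Sub.pairSub_le_iff] at hvw
  exact ((h𝓕.isConnectedMod _ (h𝓕.hull_mem hE.2.1 hE.2.2)).2 v hvw.1 w hvw.2).mono
    (le_biSup (hull 𝓕) hE)

end IsClosureFamily

/-- The closure operator determined by a closure family. -/
def ofFamily (𝓕 : Set (Sub ι)) (h𝓕 : IsClosureFamily M 𝓕) : InvariantClosure ι M where
  cl A := ⨆ F ∈ A.finiteParts M, hull 𝓕 F
  isConnectedMod_cl A hA := h𝓕.isConnectedMod_biSup_hull hA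
  le_cl A := Sub.le_of_forall_finiteParts fun F hF =>
    (le_sInf fun _ hC => hC.2).trans (le_biSup (hull 𝓕) hF)
  cl_cl_le A hA := iSup₂_le fun F hF => by
    obtain ⟨E, hE, hFE⟩ := exists_le_hull hA hF.2.2 hF.1
    have hE_mem : hull 𝓕 E ∈ {C ∈ 𝓕 | F ≤ C} := ⟨h𝓕.hull_mem hE.2.1 hE.2.2, hFE⟩
    exact (sInf_le hE_mem).trans (le_biSup (hull 𝓕) hE)
  cl_smul g A := by
    rw [Sub.finiteParts_smul, iSup_image, Sub.smul_biSup]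
    simp only [h𝓕.hull_smul]
  finitary A := biSup_congr fun F hF => (biSup_hull_eq 𝓕 hF.2.1 hF.2.2).symm

theorem ofFamily_cl_eq {𝓕 : Set (Sub ι)} (h𝓕 : IsClosureFamily M 𝓕) (hc : F.IsConnectedMod M)
    (hf : F.IsFinite) {C : Sub ι} (hC : IsLeast {C ∈ 𝓕 | F ≤ C} C) : (ofFamily 𝓕 h𝓕).cl F = C :=
  (biSup_hull_eq 𝓕 hc hf).trans hC.csInf_eq

end InvariantClosure

end Cayley

namespace Cayley

variable {X : Type u} {G : Type v} [Group G] {ι : X → G}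

theorem Sub.eq_biSup_iff {α : Type*} {A : Sub ι} {D : Set α} {f : α → Sub ι} :
    A = ⨆ F ∈ D, f F ↔
      A.verts = ⋃ F ∈ D, (f F).verts ∧ A.edges = ⋃ F ∈ D, (f F).edges := by
  rw [← sSup_image, Sub.ext_iff, verts_sSup, edges_sSup, Set.biUnion_image, Set.biUnion_image]

namespace InvariantClosure

section All

theorem biSup_isFinite_eq {f : Sub ι → Sub ι} (hf : f ⊥ = ⊥) (A : Sub ι) :
    ⨆ F ∈ {F : Sub ι | F ≤ A ∧ F.IsFinite}, f F = ⨆ F ∈ A.finiteParts ⊤, f F := by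
  refine (iSup₂_le fun F hF => ?_).antisymm (biSup_mono fun _ hF => ⟨hF.1, hF.2.2⟩)
  rcases eq_or_ne F ⊥ with rfl | hne
  · exact hf.le.trans bot_le
  · exact le_biSup f
      ⟨hF.1, Sub.isConnectedMod_top.2 (Sub.nonempty_verts_iff.2 hne), hF.2⟩

theorem cl_bot (c : InvariantClosure ι ⊤) : c.cl ⊥ = ⊥ := by
  rw [c.finitary, eq_bot_iff]
  exact iSup₂_le fun F hF =>
    absurd (le_bot_iff.1 hF.1) (Sub.nonempty_verts_iff.1 hF.2.1.1)

theorem cl_cl_le_of_top (c : InvariantClosure ι ⊤) (A : Sub ι) : c.cl (c.cl A) ≤ c.cl A := by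
  rcases eq_or_ne A ⊥ with rfl | hne
  · rw [c.cl_bot, c.cl_bot]
  · exact c.cl_cl_le A (Sub.isConnectedMod_top.2 (Sub.nonempty_verts_iff.2 hne))

/-- An invariant closure operator on nonempty subgraphs as one on all subgraphs. -/
def toClosureS (c : InvariantClosure ι ⊤) : ClosureS ι :=
  ⟨.mk' c.cl (fun _ _ => c.cl_mono) c.le_cl c.cl_cl_le_of_top,
    { invariant := c.cl_smul
      finitary_verts := fun A => (Sub.eq_biSup_iff.1
        ((c.finitary A).trans (biSup_isFinite_eq c.cl_bot A).symm)).1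
      finitary_edges := fun A => (Sub.eq_biSup_iff.1
        ((c.finitary A).trans (biSup_isFinite_eq c.cl_bot A).symm)).2
      closed_empty := Sub.empty_eq_bot (ι := ι) ▸ c.cl_bot }⟩

/-- The restriction of an invariant closure operator to nonempty subgraphs. -/
def ofClosureS (c : ClosureS ι) : InvariantClosure ι ⊤ where
  cl := c.1
  isConnectedMod_cl A hA := Sub.isConnectedMod_top.2 (hA.1.mono (c.1.le_closure A).1)
  le_cl := c.1.le_closure
  cl_cl_le A _ := (c.1.idempotent A).le
  cl_smul := c.2.invariant
  finitary A := (Sub.eq_biSup_iff.2 ⟨c.2.finitary_verts A, c.2.finitary_edges A⟩).trans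
    (biSup_isFinite_eq (Sub.empty_eq_bot (ι := ι) ▸ c.2.closed_empty) A)

/-- For `M = ⊤` the operators of part 2 are recovered: every nonempty subgraph is connected up to
jumps. -/
def orderIsoClosureS : InvariantClosure ι ⊤ ≃o ClosureS ι where
  toFun := toClosureS
  invFun := ofClosureS
  left_inv _ := rfl
  right_inv _ := Subtype.ext (ClosureOperator.ext _ _ fun _ => rfl)
  map_rel_iff' := Iff.rfl

end All

section Connected

theorem biSup_isFinite_subtype_eq (f : Sub ι → Sub ι) (A : CSub ι) :
    ⨆ F ∈ {F : CSub ι | F ≤ A ∧ F.1.IsFinite}, f F.1 = ⨆ F ∈ A.1.finiteParts ⊥, f F := by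
  apply le_antisymm
  · refine iSup₂_le fun F hF => ?_
    have hmem : F.1 ∈ A.1.finiteParts ⊥ := ⟨hF.1, Sub.isConnectedMod_bot.2 F.2, hF.2⟩
    exact le_biSup f hmem
  · refine iSup₂_le fun F hF => ?_
    have hconn : F.IsConnected := Sub.isConnectedMod_bot.1 hF.2.1
    have hmem : (⟨F, hconn⟩ : CSub ι) ∈ {F : CSub ι | F ≤ A ∧ F.1.IsFinite} := ⟨hF.1, hF.2.2⟩
    exact le_biSup (fun F : CSub ι => f F.1) hmem

/-- The restriction of an invariant closure operator to connected subgraphs. -/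
def toClosureC (c : InvariantClosure ι ⊥) : ClosureC ι :=
  have finitary (A : CSub ι) :
      c.cl A.1 = ⨆ F ∈ {F : CSub ι | F ≤ A ∧ F.1.IsFinite}, c.cl F.1 :=
    (c.finitary A.1).trans (biSup_isFinite_subtype_eq c.cl A).symm
  ⟨.mk' (fun A => ⟨c.cl A.1,
      Sub.isConnectedMod_bot.1 (c.isConnectedMod_cl _ (Sub.isConnectedMod_bot.2 A.2))⟩)
      (fun _ _ h => c.cl_mono h) (fun A => c.le_cl A.1)
      (fun A => c.cl_cl_le A.1 (Sub.isConnectedMod_bot.2 A.2)),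
    { invariant := fun g A => Subtype.ext (c.cl_smul g A.1)
      finitary_verts := fun A => (Sub.eq_biSup_iff.1 (finitary A)).1
      finitary_edges := fun A => (Sub.eq_biSup_iff.1 (finitary A)).2 }⟩

theorem isLeast_isClosed (c : ClosureC ι) (A : CSub ι) :
    IsLeast {C ∈ {C : Sub ι | ∃ h : C.IsConnected, c.1 ⟨C, h⟩ = ⟨C, h⟩} | A.1 ≤ C} (c.1 A).1 :=
  ⟨⟨⟨(c.1 A).2, c.1.idempotent A⟩, c.1.le_closure A⟩,
    fun C ⟨⟨h, hC⟩, hAC⟩ => (c.1.monotone (show A ≤ ⟨C, h⟩ from hAC)).trans_eq hC⟩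

theorem isClosureFamily_isClosed (c : ClosureC ι) :
    IsClosureFamily ⊥ {C : Sub ι | ∃ h : C.IsConnected, c.1 ⟨C, h⟩ = ⟨C, h⟩} where
  isConnectedMod C := fun ⟨h, _⟩ => Sub.isConnectedMod_bot.2 h
  smul_mem g C := fun ⟨h, hC⟩ => ⟨h.translate g, (c.2.invariant g ⟨C, h⟩).trans (by rw [hC]; rfl)⟩
  exists_isLeast F hF _ := ⟨_, isLeast_isClosed c ⟨F, Sub.isConnectedMod_bot.1 hF⟩⟩

/-- The extension of an invariant closure operator on connected subgraphs to all subgraphs. -/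
def ofClosureC (c : ClosureC ι) : InvariantClosure ι ⊥ :=
  ofFamily _ (isClosureFamily_isClosed c)

theorem ofClosureC_cl (c : ClosureC ι) (A : CSub ι) : (ofClosureC c).cl A.1 = (c.1 A).1 := by
  have cl_finite (F : CSub ι) (hF : F.1.IsFinite) : (ofClosureC c).cl F.1 = (c.1 F).1 :=
    ofFamily_cl_eq _ (Sub.isConnectedMod_bot.2 F.2) hF
      (isLeast_isClosed c F)
  rw [(ofClosureC c).finitary, ← biSup_isFinite_subtype_eq,
    biSup_congr (g := fun F : CSub ι => (c.1 F).1) fun F hF => cl_finite F hF.2]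
  exact (Sub.eq_biSup_iff.2 ⟨c.2.finitary_verts A, c.2.finitary_edges A⟩).symm

/-- For `M = ⊥` the operators of part 1 are recovered. -/
def orderIsoClosureC : InvariantClosure ι ⊥ ≃o ClosureC ι where
  toFun := toClosureC
  invFun := ofClosureC
  left_inv c :=
    have agree (F : Sub ι) (hF : F.IsTrace ⊥ 1) : (ofClosureC c.toClosureC).cl F = c.cl F :=
      ofClosureC_cl _ ⟨F, Sub.isConnectedMod_bot.1 hF.isConnectedMod⟩
    (le_of_forall_isTrace_one fun F hF => (agree F hF).le).antisymm
      (le_of_forall_isTrace_one fun F hF => (agree F hF).ge)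
  right_inv c := Subtype.ext (ClosureOperator.ext _ _ fun A => Subtype.ext (ofClosureC_cl c A))
  map_rel_iff' {_ _} :=
    ⟨fun h => le_of_forall_isTrace_one fun F hF =>
      h ⟨F, Sub.isConnectedMod_bot.1 hF.isConnectedMod⟩, fun h A => h A.1⟩

end Connected

end InvariantClosure

end Cayley

namespace Cayley

variable {X : Type u} {G : Type v} [Group G] {ι : X → G} {M : Subgroup G}

open InverseMonoid

/-- The elements of the inverse monoid of a closure operator `c`: pairs of the closure of a walk
from `1` and the endpoint of this walk, multiplied by concatenating walks. -/
@[ext]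
structure ClosedPair (c : InvariantClosure ι M) where
  graph : Sub ι
  elem : G
  exists_isTrace : ∃ F : Sub ι, F.IsTrace M elem ∧ c.cl F = graph

namespace ClosedPair

variable {c : InvariantClosure ι M} {F F' : Sub ι} {g h : G}

/-- The element given by a walk. -/
def of (c : InvariantClosure ι M) (hF : F.IsTrace M g) : ClosedPair c :=
  ⟨c.cl F, g, F, hF, rfl⟩

theorem exists_eq_of (a : ClosedPair c) : ∃ (F : Sub ι) (hF : F.IsTrace M a.elem), a = of c hF :=
  let ⟨F, hF, hc⟩ := a.exists_isTrace
  ⟨F, hF, ClosedPair.ext hc.symm rfl⟩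

theorem of_eq_of (hF : F.IsTrace M g) (hF' : F'.IsTrace M h) (hc : c.cl F = c.cl F')
    (hg : g = h) : of c hF = of c hF' :=
  ClosedPair.ext hc hg

theorem cl_graph (a : ClosedPair c) : c.cl a.graph = a.graph := by
  obtain ⟨F, hF, hc⟩ := a.exists_isTrace
  rw [← hc, c.cl_cl hF.isConnectedMod]

theorem isConnectedMod_graph (a : ClosedPair c) : a.graph.IsConnectedMod M := by
  obtain ⟨F, hF, hc⟩ := a.exists_isTrace
  exact hc ▸ c.isConnectedMod_cl F hF.isConnectedMod

theorem one_mem_graph (a : ClosedPair c) : 1 ∈ a.graph.verts := by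
  obtain ⟨F, hF, hc⟩ := a.exists_isTrace
  exact hc ▸ (c.le_cl F).1 hF.one_mem

theorem elem_mem_graph (a : ClosedPair c) : a.elem ∈ a.graph.verts := by
  obtain ⟨F, hF, hc⟩ := a.exists_isTrace
  exact hc ▸ (c.le_cl F).1 hF.mem

theorem cl_sup_smul (hF : F.IsTrace M g) (hF' : F'.IsTrace M h) :
    c.cl (c.cl F ⊔ g • c.cl F') = c.cl (F ⊔ g • F') := by
  rw [← c.cl_smul, c.cl_sup_cl (hF.mul hF').isConnectedMod]

instance : Mul (ClosedPair c) where
  mul a b := ⟨c.cl (a.graph ⊔ a.elem • b.graph), a.elem * b.elem, by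
    obtain ⟨F, hF, hc⟩ := a.exists_isTrace
    obtain ⟨F', hF', hc'⟩ := b.exists_isTrace
    exact ⟨_, hF.mul hF', by rw [← hc, ← hc', cl_sup_smul hF hF']⟩⟩

instance : One (ClosedPair c) := ⟨of c .one⟩

instance : Inv (ClosedPair c) where
  inv a := ⟨a.elem⁻¹ • a.graph, a.elem⁻¹, by
    obtain ⟨F, hF, hc⟩ := a.exists_isTrace
    exact ⟨_, hF.inv, by rw [c.cl_smul, hc]⟩⟩

theorem graph_mul (a b : ClosedPair c) : (a * b).graph = c.cl (a.graph ⊔ a.elem • b.graph) := rfl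

theorem graph_inv (a : ClosedPair c) : a⁻¹.graph = a.elem⁻¹ • a.graph := rfl

theorem elem_mul (a b : ClosedPair c) : (a * b).elem = a.elem * b.elem := rfl

theorem of_mul_of (hF : F.IsTrace M g) (hF' : F'.IsTrace M h) :
    of c hF * of c hF' = of c (hF.mul hF') :=
  ClosedPair.ext (cl_sup_smul hF hF') rfl

theorem of_inv (hF : F.IsTrace M g) : (of c hF)⁻¹ = of c hF.inv :=
  ClosedPair.ext (c.cl_smul _ F).symm rfl

theorem one_eq_of : (1 : ClosedPair c) = of c .one := rfl

theorem graph_le_graph_mul (a b : ClosedPair c) : a.graph ≤ (a * b).graph :=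
  le_sup_left.trans (c.le_cl _)

theorem smul_graph_le_graph_mul (a b : ClosedPair c) : a.elem • b.graph ≤ (a * b).graph :=
  le_sup_right.trans (c.le_cl _)

instance : Monoid (ClosedPair c) where
  mul_assoc a₁ a₂ a₃ := by
    obtain ⟨F₁, hF₁, h₁⟩ := a₁.exists_eq_of
    obtain ⟨F₂, hF₂, h₂⟩ := a₂.exists_eq_of
    obtain ⟨F₃, hF₃, h₃⟩ := a₃.exists_eq_of
    rw [h₁, h₂, h₃]
    simp only [of_mul_of]
    refine of_eq_of _ _ ?_ (mul_assoc _ _ _)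
    rw [Sub.smul_sup, smul_smul, sup_assoc]
  one_mul a := by
    obtain ⟨F, hF, h⟩ := a.exists_eq_of
    rw [h, one_eq_of, of_mul_of]
    refine of_eq_of _ _ ?_ (one_mul _)
    rw [one_smul, sup_eq_right.2 (Sub.pairSub_le_iff.2 ⟨hF.one_mem, hF.one_mem⟩)]
  mul_one a := by
    obtain ⟨F, hF, h⟩ := a.exists_eq_of
    rw [h, one_eq_of, of_mul_of]
    refine of_eq_of _ _ ?_ (mul_one _)
    rw [Sub.smul_pairSub, mul_one, sup_eq_left.2 (Sub.pairSub_le_iff.2 ⟨hF.mem, hF.mem⟩)]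

theorem mul_inv_mul_self (a : ClosedPair c) : a * a⁻¹ * a = a := by
  obtain ⟨F, hF, h⟩ := a.exists_eq_of
  rw [h, of_inv, of_mul_of, of_mul_of]
  refine of_eq_of _ _ ?_ (by group)
  rw [smul_inv_smul, mul_inv_cancel, one_smul, sup_idem, sup_idem]

theorem inv_inv_self (a : ClosedPair c) : a⁻¹⁻¹ = a :=
  ClosedPair.ext (inv_smul_smul a.elem⁻¹ a.graph) (_root_.inv_inv _)

theorem graph_le_smul_graph {a b : ClosedPair c} (h : a * b * a = a) :
    b.graph ≤ a.elem⁻¹ • a.graph := by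
  have hle := (smul_graph_le_graph_mul a b).trans (graph_le_graph_mul (a * b) a)
  rwa [h, Sub.smul_le_iff] at hle

instance : InverseMonoid (ClosedPair c) where
  mul_inv_mul := mul_inv_mul_self
  inv_mul_inv a := by
    nth_rw 2 [← inv_inv_self a]
    exact mul_inv_mul_self a⁻¹
  inv_unique a b hab hba := by
    have helem : b.elem = a.elem⁻¹ :=
      eq_inv_of_mul_eq_one_right (mul_eq_right.1 (congrArg elem hab))
    refine ClosedPair.ext ((graph_le_smul_graph hab).antisymm ?_) helem
    rw [Sub.smul_le_iff, ← helem]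
    exact graph_le_smul_graph hba

/-- The projection onto `G`. -/
def proj (c : InvariantClosure ι M) : ClosedPair c →* G where
  toFun := elem
  map_one' := rfl
  map_mul' := elem_mul

/-- The generators: the walks along a single edge. -/
def gen (c : InvariantClosure ι M) (x : X) : ClosedPair c := of c (.letter (x, true))

theorem proj_gen (c : InvariantClosure ι M) (x : X) : proj c (gen c x) = ι x := rfl

theorem of_letter (x : X) (b : Bool) :
    of c (.letter (x, b)) = if b then gen c x else (gen c x)⁻¹ := by
  cases b
  · rw [gen, if_neg Bool.false_ne_true, of_inv]
    refine of_eq_of _ _ (congrArg _ ?_) rfl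
    rw [Sub.smul_edgeSub, ← Sub.edgeSub_inverse]
    simp [Edge.inverse, Edge.target, Edge.translate, letterVal]
  · rfl

theorem dom_graph (a : ClosedPair c) : (dom a).graph = a.graph := by
  rw [dom, graph_mul, graph_inv, smul_inv_smul, sup_idem, cl_graph]

theorem dom_elem (a : ClosedPair c) : (dom a).elem = 1 :=
  mul_inv_cancel a.elem

theorem idempotentPure_proj (c : InvariantClosure ι M) : IdempotentPure (proj c) := fun a ha => by
  have hdom : dom a = a := ClosedPair.ext a.dom_graph (a.dom_elem.trans ha.symm)
  exact hdom ▸ isIdempotentElem_dom a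

theorem isFibreMax_jump (hg : g ∈ M) : IsFibreMax (proj c) (of c (.jump hg)) := fun a ha => by
  obtain rfl : a.elem = g := ha
  have hle : c.cl (Sub.pairSub ι 1 a.elem) ≤ a.graph :=
    (c.cl_mono (Sub.pairSub_le_iff.2 ⟨a.one_mem_graph, a.elem_mem_graph⟩)).trans a.cl_graph.le
  refine ClosedPair.ext ?_ ((congrArg (· * a.elem) a.dom_elem).trans (one_mul _)).symm
  rw [← dom, graph_mul, dom_graph, dom_elem, one_smul, of, sup_eq_left.2 hle, cl_graph]

theorem of_mem {T : Set (ClosedPair c)} (hgen : ∀ x, gen c x ∈ T)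
    (hjump : ∀ {g : G} (hg : g ∈ M), of c (.jump hg) ∈ T) (hmul : ∀ a ∈ T, ∀ b ∈ T, a * b ∈ T)
    (hinv : ∀ a ∈ T, a⁻¹ ∈ T) (hF : F.IsTrace M g) : of c hF ∈ T := by
  induction hF with
  | jump hg => exact hjump hg
  | letter a =>
    obtain ⟨x, b⟩ := a
    rw [of_letter]
    cases b
    exacts [hinv _ (hgen x), hgen x]
  | mul hF hF' ih ih' => exact of_mul_of hF hF' ▸ hmul _ ih _ ih'

section Functoriality

variable {c c' : InvariantClosure ι M}

/-- The homomorphism induced by an inequality of closure operators. -/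
def map (h : c ≤ c') : ClosedPair c →* ClosedPair c' where
  toFun a := ⟨c'.cl a.graph, a.elem, by
    obtain ⟨F, hF, hc⟩ := a.exists_isTrace
    exact ⟨F, hF, hc ▸ (InvariantClosure.cl_cl_of_le h hF.isConnectedMod).symm⟩⟩
  map_one' := ClosedPair.ext (InvariantClosure.cl_cl_of_le h Sub.IsTrace.one.isConnectedMod) rfl
  map_mul' a b := by
    obtain ⟨F, hF, ha⟩ := a.exists_eq_of
    obtain ⟨F', hF', hb⟩ := b.exists_eq_of
    have map_of {F : Sub ι} {g : G} (hF : F.IsTrace M g) : c'.cl (c.cl F) = c'.cl F :=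
      InvariantClosure.cl_cl_of_le h hF.isConnectedMod
    refine ClosedPair.ext ?_ rfl
    rw [ha, hb, of_mul_of, graph_mul]
    simp only [of]
    rw [map_of (hF.mul hF'), map_of hF, map_of hF', cl_sup_smul hF hF']

theorem map_of (h : c ≤ c') (hF : F.IsTrace M g) : map h (of c hF) = of c' hF :=
  ClosedPair.ext (InvariantClosure.cl_cl_of_le h hF.isConnectedMod) rfl

theorem map_gen (h : c ≤ c') (x : X) : map h (gen c x) = gen c' x := map_of h _

theorem map_refl : map (le_refl c) = .id (ClosedPair c) :=
  MonoidHom.ext fun a => ClosedPair.ext a.cl_graph rfl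

theorem map_trans {c'' : InvariantClosure ι M} (h : c ≤ c') (h' : c' ≤ c'') :
    map (h.trans h') = (map h').comp (map h) :=
  MonoidHom.ext fun a =>
    ClosedPair.ext (InvariantClosure.cl_cl_of_le h' a.isConnectedMod_graph).symm rfl

theorem hom_of_eq_of (φ : ClosedPair c →* ClosedPair c') (hgen : ∀ x, φ (gen c x) = gen c' x)
    (hjump : ∀ {g : G} (hg : g ∈ M), φ (of c (.jump hg)) = of c' (.jump hg))
    (hF : F.IsTrace M g) : φ (of c hF) = of c' hF := by
  induction hF with
  | jump hg => exact hjump hg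
  | letter a =>
    obtain ⟨x, b⟩ := a
    rw [of_letter, of_letter]
    cases b <;> simp [InverseMonoid.map_inv, hgen]
  | mul hF hF' ih ih' => rw [← of_mul_of hF hF', map_mul, ih, ih', of_mul_of]

/-- Adding to a walk any finite part of its closure does not change the element it gives. -/
theorem le_of_hom (φ : ClosedPair c →* ClosedPair c') (hgen : ∀ x, φ (gen c x) = gen c' x)
    (hjump : ∀ {g : G} (hg : g ∈ M), φ (of c (.jump hg)) = of c' (.jump hg)) : c ≤ c' := by
  refine InvariantClosure.le_of_forall_isTrace_one fun F hF => ?_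
  have hcl := c.isConnectedMod_cl F hF.isConnectedMod
  have hF_mem : F ∈ (c.cl F).finiteParts M := ⟨c.le_cl F, hF.isConnectedMod, hF.isFinite⟩
  refine Sub.le_of_forall_finiteParts (M := M) fun E hE => ?_
  obtain ⟨K, ⟨hK, hKc, hKf⟩, hFK, hEK⟩ := hcl.directedOn_finiteParts F hF_mem E hE
  have hK' : K.IsTrace M 1 := Sub.isTrace_iff.2 ⟨hKc, hKf, hFK.1 hF.one_mem, hFK.1 hF.one_mem⟩
  have heq : of c hK' = of c hF :=
    of_eq_of _ _ ((c.cl_le_cl hF.isConnectedMod hK).antisymm (c.cl_mono hFK)) rfl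
  have heq' : of c' hK' = of c' hF := by
    rw [← hom_of_eq_of φ hgen hjump hK', heq, hom_of_eq_of φ hgen hjump]
  calc E ≤ K := hEK
    _ ≤ c'.cl K := c'.le_cl K
    _ = c'.cl F := congrArg graph heq'

theorem eq_map (φ : ClosedPair c →* ClosedPair c') (hgen : ∀ x, φ (gen c x) = gen c' x)
    (hjump : ∀ {g : G} (hg : g ∈ M), φ (of c (.jump hg)) = of c' (.jump hg)) (h : c ≤ c') :
    φ = map h :=
  MonoidHom.ext fun a => by
    obtain ⟨F, hF, ha⟩ := a.exists_eq_of
    rw [ha, hom_of_eq_of φ hgen hjump, map_of]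

end Functoriality

end ClosedPair

end Cayley

namespace Cayley

open InverseMonoid

section Letter

variable {X : Type u} {S : Type*} [InverseMonoid S]

/-- The value of a letter of `X ∪ X⁻¹` in an inverse monoid, as `letterVal` for groups. -/
def letterIn (gen : X → S) (a : X × Bool) : S := if a.2 then gen a.1 else (gen a.1)⁻¹

theorem letterIn_not (gen : X → S) (x : X) (b : Bool) :
    letterIn gen (x, !b) = (letterIn gen (x, b))⁻¹ := by
  cases b <;> simp [letterIn]

end Letter

variable {X : Type u} {G : Type v} [Group G] {ι : X → G} {S : Type*} [InverseMonoid S]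
  {gen : X → S} {π : S →* G}

theorem map_letterIn (hgen : ∀ x, π (gen x) = ι x) (a : X × Bool) :
    π (letterIn gen a) = letterVal ι a := by
  obtain ⟨x, b⟩ := a
  cases b <;> simp [letterIn, letterVal, map_inv_of_group, hgen]

/-- The Schützenberger graph of an idempotent `e`: the elements above `e` in the `𝓡`-order, read
off in `G`. If `π` is idempotent pure then it is injective on the `𝓡`-class of `e`, so that no
information is lost. -/
def schutzenbergerGraph (hgen : ∀ x, π (gen x) = ι x) (e : S) : Sub ι where
  verts := {g | ∃ t, π t = g ∧ e * dom t = e}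
  edges := {x | ∃ t, π t = x.1 ∧ e * dom (t * letterIn gen x.2) = e}
  source_mem := fun _ ⟨t, ht, hte⟩ => ⟨t, ht, mul_dom_of_mul_dom_mul hte⟩
  target_mem := fun _ ⟨_, ht, hte⟩ =>
    ⟨_, by rw [map_mul, ht, map_letterIn hgen, Edge.target], hte⟩
  inverse_mem := by
    rintro ⟨_, x, b⟩ ⟨t, rfl, hte⟩
    refine ⟨t * letterIn gen (x, b), by rw [map_mul, map_letterIn hgen]; rfl, ?_⟩
    have hdom : dom (t * letterIn gen (x, b) * letterIn gen (x, !b)) =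
        dom (t * letterIn gen (x, b)) := by
      rw [letterIn_not, mul_assoc, ← dom, dom_mul, dom_of_isIdempotentElem (isIdempotentElem_dom _),
        dom_mul]
    exact (congrArg (e * ·) hdom).trans hte

section SchutzenbergerGraph

variable {hgen : ∀ x, π (gen x) = ι x} {e f s : S}

theorem one_mem_schutzenbergerGraph : 1 ∈ (schutzenbergerGraph hgen e).verts :=
  ⟨1, map_one π, by rw [dom_one, mul_one]⟩

theorem schutzenbergerGraph_anti (hef : e * f = e) :
    schutzenbergerGraph hgen f ≤ schutzenbergerGraph hgen e := by
  have absorb {x : S} (hx : f * x = f) : e * x = e := by rw [← hef, mul_assoc, hx]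
  exact ⟨fun _ ⟨t, ht, hf⟩ => ⟨t, ht, absorb hf⟩, fun _ ⟨t, ht, hf⟩ => ⟨t, ht, absorb hf⟩⟩

/-- Left multiplication by `s` and by `s⁻¹` translates between both sides. -/
theorem exists_map_eq_mul_dom_iff (he : IsIdempotentElem e) (hes : e * dom s = e) (g : G) (r : S) :
    (∃ t, π t = (π s)⁻¹ * g ∧ s⁻¹ * e * s * dom (t * r) = s⁻¹ * e * s) ↔
      ∃ t, π t = g ∧ e * dom (t * r) = e := by
  constructor
  · rintro ⟨t, ht, hr⟩
    refine ⟨s * t, by rw [map_mul, ht, mul_inv_cancel_left], ?_⟩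
    rw [mul_assoc, mul_dom_mul_eq_iff he]
    exact ⟨hes, hr⟩
  · rintro ⟨t, rfl, ht⟩
    refine ⟨s⁻¹ * t, by rw [map_mul, map_inv_of_group], ?_⟩
    rw [mul_assoc s⁻¹ t r, mul_dom_mul_eq_iff (isIdempotentElem_conj he hes), conj_inv_conj he hes]
    exact ⟨conj_mul_dom_inv e s, ht⟩

theorem smul_schutzenbergerGraph_conj (he : IsIdempotentElem e) (hes : e * dom s = e) :
    π s • schutzenbergerGraph hgen (s⁻¹ * e * s) = schutzenbergerGraph hgen e := by
  refine Sub.ext (Set.ext fun g => ?_) (Set.ext fun x => ?_)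
  · rw [Sub.mem_verts_smul]
    simpa only [mul_one] using! exists_map_eq_mul_dom_iff he hes g 1
  · rw [Sub.mem_edges_smul]
    exact exists_map_eq_mul_dom_iff he hes x.1 (letterIn gen x.2)

end SchutzenbergerGraph

/-- The idempotent `f` is the largest one whose Schützenberger graph contains `F`. -/
structure Covers (hgen : ∀ x, π (gen x) = ι x) (F : Sub ι) (f : S) : Prop where
  idem : IsIdempotentElem f
  le_iff : ∀ e, IsIdempotentElem e → (F ≤ schutzenbergerGraph hgen e ↔ e * f = e)

namespace Covers

variable {hgen : ∀ x, π (gen x) = ι x} {F A B : Sub ι} {f s t : S}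

theorem le (hF : Covers hgen F f) : F ≤ schutzenbergerGraph hgen f :=
  (hF.le_iff f hF.idem).2 hF.idem

theorem letter (hπ : IdempotentPure π) (a : X × Bool) :
    Covers hgen (Sub.edgeSub (1, a)) (dom (letterIn gen a)) := by
  refine ⟨isIdempotentElem_dom _, fun e _ => Sub.edgeSub_le_iff.trans ⟨?_, fun ha => ?_⟩⟩
  · rintro ⟨t, ht, hta⟩
    rw [← hta, dom_mul_of_isIdempotentElem (hπ t ht), mul_assoc, mul_assoc, isIdempotentElem_dom]
  · exact ⟨1, map_one π, by rwa [one_mul]⟩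

theorem pair {m : S} (hm : IsFibreMax π m) : Covers hgen (Sub.pairSub ι 1 (π m)) (dom m) := by
  refine ⟨isIdempotentElem_dom _, fun e _ => Sub.pairSub_le_iff.trans ⟨?_, fun hem => ?_⟩⟩
  · rintro ⟨-, t, ht, hte⟩
    rw [← hte, mul_assoc, (hm t ht).dom_mul_dom]
  · exact ⟨one_mem_schutzenbergerGraph, m, rfl, hem⟩

theorem mul (hA : Covers hgen A (dom s)) (hB : Covers hgen B (dom t)) :
    Covers hgen (A ⊔ π s • B) (dom (s * t)) := by
  refine ⟨isIdempotentElem_dom _, fun e he => ?_⟩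
  rw [sup_le_iff, hA.le_iff e he, mul_dom_mul_eq_iff he]
  refine and_congr_right fun hs => ?_
  rw [← smul_schutzenbergerGraph_conj he hs, Sub.smul_le_smul_iff,
    hB.le_iff _ (isIdempotentElem_conj he hs)]

theorem inv (hπ : IdempotentPure π) (hA : Covers hgen A (dom s)) (h1 : 1 ∈ A.verts) :
    Covers hgen ((π s)⁻¹ • A) (dom s⁻¹) := by
  refine ⟨isIdempotentElem_dom _, fun e he => ⟨fun hle => ?_, fun hes => ?_⟩⟩
  · obtain ⟨t, ht, hte⟩ : (π s)⁻¹ ∈ (schutzenbergerGraph hgen e).verts :=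
      hle.1 (by simpa [Sub.mem_verts_smul] using h1)
    rw [← smul_schutzenbergerGraph_conj he hte, ht, Sub.smul_le_smul_iff,
      hA.le_iff _ (isIdempotentElem_conj he hte)] at hle
    have hets := (mul_dom_mul_eq_iff he).2 ⟨hte, hle⟩
    rw [dom_of_isIdempotentElem (hπ _ (by rw [map_mul, ht, inv_mul_cancel]))] at hets
    calc e * dom s⁻¹ = e * (t * (s * s⁻¹ * s)) := by
          nth_rw 1 [← hets]
          simp only [dom_inv, mul_assoc]
      _ = e := by rw [mul_inv_mul, hets]
  · rw [← smul_schutzenbergerGraph_conj he hes, map_inv_of_group, Sub.smul_le_smul_iff,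
      hA.le_iff _ (isIdempotentElem_conj he hes)]
    simpa only [_root_.inv_inv] using conj_mul_dom_inv e s⁻¹

end Covers

/-- The translates of the Schützenberger graphs of idempotents. -/
def schutzenbergerFamily (hgen : ∀ x, π (gen x) = ι x) : Set (Sub ι) :=
  {C | ∃ (g : G) (e : S), IsIdempotentElem e ∧ C = g • schutzenbergerGraph hgen e}

theorem Covers.isLeast {hgen : ∀ x, π (gen x) = ι x} {F : Sub ι} {f : S} {v : G}
    (hF : Covers hgen (v⁻¹ • F) f) (hv : v ∈ F.verts) :
    IsLeast {C ∈ schutzenbergerFamily hgen | F ≤ C} (v • schutzenbergerGraph hgen f) := by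
  refine ⟨⟨⟨v, f, hF.idem, rfl⟩, ?_⟩, ?_⟩
  · simpa only [Sub.smul_le_iff, _root_.inv_inv] using hF.le
  rintro _ ⟨⟨g, e, he, rfl⟩, hle⟩
  obtain ⟨s, hs, hse⟩ := Sub.mem_verts_smul.1 (hle.1 hv)
  have hbase : g • schutzenbergerGraph hgen e =
      v • schutzenbergerGraph hgen (s⁻¹ * e * s) := by
    rw [← smul_schutzenbergerGraph_conj he hse, smul_smul, hs, mul_inv_cancel_left]
  rw [hbase] at hle ⊢
  refine Sub.smul_mono v (schutzenbergerGraph_anti ?_)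
  rwa [← hF.le_iff _ (isIdempotentElem_conj he hse), Sub.smul_le_iff, _root_.inv_inv]

end Cayley

namespace Cayley

open InverseMonoid

variable {X : Type u} {G : Type v} [Group G] {ι : X → G} {M : Subgroup G} {S : Type*}
  [InverseMonoid S] {gen : X → S} {π : S →* G}

/-- What the `E`-unitary inverse monoids (`M = ⊥`) and the `F`-inverse monoids (`M = ⊤`) have in
common: the fibres of `π` over `M` have greatest elements, and these together with the generators
generate `S` as an inverse semigroup. -/
structure IsModel (ι : X → G) (M : Subgroup G) (gen : X → S) (π : S →* G) : Prop where
  map_gen : ∀ x, π (gen x) = ι x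
  idempotentPure : IdempotentPure π
  exists_isFibreMax : ∀ g ∈ M, ∃ m, π m = g ∧ IsFibreMax π m
  generated : ∀ T : Set S, (∀ x, gen x ∈ T) → (∀ m, π m ∈ M → IsFibreMax π m → m ∈ T) →
    (∀ a ∈ T, ∀ b ∈ T, a * b ∈ T) → (∀ a ∈ T, a⁻¹ ∈ T) → T = Set.univ

namespace IsModel

variable (h : IsModel ι M gen π)

include h

theorem exists_isTrace_covers (s : S) :
    ∃ F : Sub ι, F.IsTrace M (π s) ∧ Covers h.map_gen F (dom s) := by
  let T : Set S := {s | ∃ F : Sub ι, F.IsTrace M (π s) ∧ Covers h.map_gen F (dom s)}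
  have hT : T = Set.univ := by
    refine h.generated T (fun x => ?_) (fun m hmM hm => ⟨_, .jump hmM, .pair hm⟩) ?_ ?_
    · refine ⟨_, ?_, .letter h.idempotentPure (x, true)⟩
      simpa only [h.map_gen] using! Sub.IsTrace.letter (x, true)
    · rintro s ⟨F, hF, hFs⟩ t ⟨E, hE, hEt⟩
      exact ⟨_, by rw [map_mul]; exact hF.mul hE, hFs.mul hEt⟩
    · rintro s ⟨F, hF, hFs⟩
      exact ⟨_, by rw [map_inv_of_group]; exact hF.inv, hFs.inv h.idempotentPure hF.one_mem⟩
  exact hT.ge (Set.mem_univ s)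

theorem exists_covers {F : Sub ι} {g : G} (hF : F.IsTrace M g) :
    ∃ s, π s = g ∧ Covers h.map_gen F (dom s) := by
  induction hF with
  | jump hg =>
    obtain ⟨m, rfl, hm⟩ := h.exists_isFibreMax _ hg
    exact ⟨m, rfl, .pair hm⟩
  | letter a => exact ⟨letterIn gen a, map_letterIn h.map_gen a, .letter h.idempotentPure a⟩
  | mul _ _ ihA ihB =>
    obtain ⟨⟨s, rfl, hs⟩, t, rfl, ht⟩ := ihA, ihB
    exact ⟨s * t, map_mul π s t, hs.mul ht⟩

theorem isConnectedMod_schutzenbergerGraph (e : S) :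
    (schutzenbergerGraph h.map_gen e).IsConnectedMod M := by
  refine .of_joined one_mem_schutzenbergerGraph ?_
  rintro _ ⟨t, rfl, ht⟩
  obtain ⟨F, hF, hFt⟩ := h.exists_isTrace_covers t
  exact (Sub.Joined.of_isTrace hF).mono (hFt.le.trans (schutzenbergerGraph_anti ht))

theorem isClosureFamily_schutzenbergerFamily :
    InvariantClosure.IsClosureFamily M (schutzenbergerFamily h.map_gen) where
  isConnectedMod := by
    rintro _ ⟨g, e, -, rfl⟩
    exact (h.isConnectedMod_schutzenbergerGraph e).smul g
  smul_mem := by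
    rintro k _ ⟨g, e, he, rfl⟩
    exact ⟨k * g, e, he, smul_smul ..⟩
  exists_isLeast F hc hf := by
    obtain ⟨v, hv⟩ := hc.1
    have hone : 1 ∈ (v⁻¹ • F).verts := by simpa [Sub.mem_verts_smul] using hv
    obtain ⟨s, -, hs⟩ :=
      h.exists_covers (Sub.isTrace_iff.2 ⟨hc.smul v⁻¹, hf.smul v⁻¹, hone, hone⟩)
    exact ⟨_, hs.isLeast hv⟩

/-- The closure of a finite subgraph is the least translate of a Schützenberger graph above it. -/
def closure : InvariantClosure ι M :=
  .ofFamily (schutzenbergerFamily h.map_gen) h.isClosureFamily_schutzenbergerFamily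

theorem closure_cl_eq {F : Sub ι} {f : S} {g : G} (hF : F.IsTrace M g)
    (hFf : Covers h.map_gen F f) : h.closure.cl F = schutzenbergerGraph h.map_gen f := by
  have hleast := Covers.isLeast (v := 1) (by rwa [inv_one, one_smul]) hF.one_mem
  rw [one_smul] at hleast
  exact InvariantClosure.ofFamily_cl_eq _ hF.isConnectedMod hF.isFinite hleast

/-- The element `s` is recovered from the Schützenberger graph of its `𝓡`-class and its image in
`G`. -/
def toClosedPair (s : S) : ClosedPair h.closure where
  graph := schutzenbergerGraph h.map_gen (dom s)
  elem := π s
  exists_isTrace :=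
    let ⟨F, hF, hFs⟩ := h.exists_isTrace_covers s
    ⟨F, hF, h.closure_cl_eq hF hFs⟩

theorem toClosedPair_eq_of {s : S} {F : Sub ι} {g : G} (hF : F.IsTrace M g) (hs : π s = g)
    (hFs : Covers h.map_gen F (dom s)) : h.toClosedPair s = .of h.closure hF :=
  ClosedPair.ext (h.closure_cl_eq hF hFs).symm hs

theorem toClosedPair_mul (s t : S) :
    h.toClosedPair (s * t) = h.toClosedPair s * h.toClosedPair t := by
  obtain ⟨F, hF, hFs⟩ := h.exists_isTrace_covers s
  obtain ⟨E, hE, hEt⟩ := h.exists_isTrace_covers t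
  rw [h.toClosedPair_eq_of hF rfl hFs, h.toClosedPair_eq_of hE rfl hEt, ClosedPair.of_mul_of,
    h.toClosedPair_eq_of (hF.mul hE) (map_mul π s t) (hFs.mul hEt)]

theorem toClosedPair_injective : Function.Injective h.toClosedPair := fun s t hst => by
  have dom_le {s t : S} (hst : h.toClosedPair s = h.toClosedPair t) :
      dom t * dom s = dom t := by
    obtain ⟨F, -, hFs⟩ := h.exists_isTrace_covers s
    exact (hFs.le_iff _ (isIdempotentElem_dom t)).1
      (hFs.le.trans (congrArg ClosedPair.graph hst).le)
  refine h.idempotentPure.eq_of_dom_eq ?_ (congrArg ClosedPair.elem hst)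
  rw [← dom_le hst, idem_comm (isIdempotentElem_dom t) (isIdempotentElem_dom s), dom_le hst.symm]

theorem toClosedPair_surjective : Function.Surjective h.toClosedPair := fun a => by
  obtain ⟨F, hF, ha⟩ := a.exists_eq_of
  obtain ⟨s, hs, hFs⟩ := h.exists_covers hF
  exact ⟨s, (h.toClosedPair_eq_of hF hs hFs).trans ha.symm⟩

/-- Every model is the monoid of closed pairs of its closure operator. -/
noncomputable def mulEquivClosedPair : S ≃* ClosedPair h.closure :=
  .ofBijective (⟨h.toClosedPair, h.toClosedPair_mul⟩ : S →ₙ* ClosedPair h.closure)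
    ⟨h.toClosedPair_injective, h.toClosedPair_surjective⟩

theorem mulEquivClosedPair_gen (x : X) :
    h.mulEquivClosedPair (gen x) = ClosedPair.gen h.closure x :=
  h.toClosedPair_eq_of (.letter (x, true)) (h.map_gen x) (.letter h.idempotentPure (x, true))

theorem proj_mulEquivClosedPair (s : S) :
    ClosedPair.proj h.closure (h.mulEquivClosedPair s) = π s :=
  rfl

end IsModel

end Cayley

namespace EUnitaryOver

open InverseMonoid Cayley

variable {X : Type u} {G : Type v} [Group G] {ι : X → G}

/-- The isomorphism given by a canonical isomorphism of monoids. -/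
def isoOfMulEquiv {S T : EUnitaryOver ι} (e : S.carrier ≃* T.carrier)
    (hgen : ∀ x, e (S.gen x) = T.gen x) : S ≅ T where
  hom := ⟨e.toMonoidHom, InverseMonoid.map_inv e.toMonoidHom, hgen⟩
  inv := ⟨e.symm.toMonoidHom, InverseMonoid.map_inv e.symm.toMonoidHom,
    fun x => e.symm_apply_eq.2 (hgen x).symm⟩
  hom_inv_id := Hom.ext (MonoidHom.ext e.symm_apply_apply)
  inv_hom_id := Hom.ext (MonoidHom.ext e.apply_symm_apply)

theorem isModel (S : EUnitaryOver ι) : IsModel ι ⊥ S.gen S.proj where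
  map_gen := S.proj_gen
  idempotentPure := S.eUnitary.idempotentPure S.proj_greatest
  exists_isFibreMax g hg := ⟨1, by rw [map_one, Subgroup.mem_bot.1 hg],
    (S.eUnitary.idempotentPure S.proj_greatest).isFibreMax_one⟩
  generated T hgen hmax := S.generated T hgen <| hmax 1 (by rw [map_one]; exact one_mem _)
    (S.eUnitary.idempotentPure S.proj_greatest).isFibreMax_one

end EUnitaryOver

namespace FInverseOver

open InverseMonoid Cayley

variable {X : Type u} {G : Type v} [Group G] {ι : X → G}

/-- The isomorphism given by a canonical isomorphism of monoids that respects the projections. -/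
def isoOfMulEquiv {S T : FInverseOver ι} (e : S.carrier ≃* T.carrier)
    (hgen : ∀ x, e (S.gen x) = T.gen x) (hproj : ∀ s, T.proj (e s) = S.proj s) : S ≅ T :=
  have map_maxElt {S T : FInverseOver ι} (e : S.carrier ≃* T.carrier)
      (hproj : ∀ s, T.proj (e s) = S.proj s) (a : S.carrier) :
      e (FInverseMonoid.maxElt a) = FInverseMonoid.maxElt (e a) :=
    FInverseMonoid.eq_maxElt T.proj_greatest
      ((FInverseMonoid.isFibreMax_maxElt S.proj_greatest a).map_mulEquiv e hproj)
      (by rw [hproj, hproj, FInverseMonoid.map_maxElt])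
  { hom := ⟨e.toMonoidHom, InverseMonoid.map_inv e.toMonoidHom, map_maxElt e hproj, hgen⟩
    inv := ⟨e.symm.toMonoidHom, InverseMonoid.map_inv e.symm.toMonoidHom,
      map_maxElt e.symm fun t => by rw [← hproj, e.apply_symm_apply],
      fun x => e.symm_apply_eq.2 (hgen x).symm⟩
    hom_inv_id := Hom.ext (MonoidHom.ext e.symm_apply_apply)
    inv_hom_id := Hom.ext (MonoidHom.ext e.apply_symm_apply) }

theorem isModel (S : FInverseOver ι) : IsModel ι ⊤ S.gen S.proj where
  map_gen := S.proj_gen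
  idempotentPure := (FInverseMonoid.isEUnitary S.carrier).idempotentPure S.proj_greatest
  exists_isFibreMax g _ := by
    obtain ⟨a, rfl⟩ := S.proj_greatest.1 g
    exact ⟨_, FInverseMonoid.map_maxElt S.proj a,
      FInverseMonoid.isFibreMax_maxElt S.proj_greatest a⟩
  generated T hgen hmax hmul hinv :=
    S.generated T hgen
      (hmax 1 (Subgroup.mem_top _)
        ((FInverseMonoid.isEUnitary S.carrier).idempotentPure S.proj_greatest).isFibreMax_one)
      hmul hinv
      fun a _ => hmax _ (Subgroup.mem_top _) (FInverseMonoid.isFibreMax_maxElt S.proj_greatest a)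

end FInverseOver

namespace Cayley

open InverseMonoid

variable {X : Type u} {G : Type v} [Group G] {ι : X → G}

namespace ClosedPair

theorem proj_surjective (hι : Subgroup.closure (Set.range ι) = ⊤) {M : Subgroup G}
    (c : InvariantClosure ι M) : Function.Surjective (proj c) := fun g =>
  let ⟨a, _, ha⟩ := exists_mem_map_eq hι (π := proj c) (gen := gen c)
    (ClosedPair.proj_gen c) (T := Set.univ) (by simp) trivial (by simp) (by simp) g
  ⟨a, ha⟩

section EUnitary

variable {c : InvariantClosure ι ⊥}

theorem jump_bot {g : G} (hg : g ∈ (⊥ : Subgroup G)) : of c (.jump hg) = 1 := by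
  obtain rfl := Subgroup.mem_bot.1 hg
  rfl

/-- The `E`-unitary inverse monoid of a closure operator on connected subgraphs. -/
def eUnitaryOver (hι : Subgroup.closure (Set.range ι) = ⊤) (c : InvariantClosure ι ⊥) :
    EUnitaryOver ι where
  carrier := ClosedPair c
  gen := gen c
  generated T hgen hone hmul hinv := Set.eq_univ_of_forall fun a => by
    obtain ⟨F, hF, ha⟩ := a.exists_eq_of
    exact ha ▸ of_mem hgen (fun hg => jump_bot hg ▸ hone) hmul hinv hF
  eUnitary := (idempotentPure_proj c).isEUnitary
  proj := proj c
  proj_gen := ClosedPair.proj_gen c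
  proj_greatest := (idempotentPure_proj c).isGreatestGroupImage (proj_surjective hι c)

end EUnitary

section FInverse

variable {c c' : InvariantClosure ι ⊤}

instance : FInverseMonoid (ClosedPair c) where
  maxElt a := of c (.jump (Subgroup.mem_top a.elem))
  maxElt_sigma _ := (idempotentPure_proj c).map_eq_iff_sigma.1 rfl
  le_maxElt a b h :=
    isFibreMax_jump (Subgroup.mem_top a.elem) b (map_eq_of_sigma (proj c) h : proj c b = proj c a)

theorem map_jump_top (hι : Subgroup.closure (Set.range ι) = ⊤) (φ : ClosedPair c →* ClosedPair c')
    (hgen : ∀ x, φ (gen c x) = gen c' x)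
    (hmax : ∀ a, φ (FInverseMonoid.maxElt a) = FInverseMonoid.maxElt (φ a)) {g : G}
    (hg : g ∈ (⊤ : Subgroup G)) : φ (of c (.jump hg)) = of c' (.jump hg) := by
  obtain ⟨a, ha, rfl⟩ : ∃ a ∈ {a | (φ a).elem = a.elem}, proj c a = g := by
    refine exists_mem_map_eq hι (gen := gen c) (ClosedPair.proj_gen c) (fun x => ?_) ?_ ?_ ?_ g
    · exact congrArg elem (hgen x)
    · exact congrArg elem (map_one φ)
    · intro a ha b hb
      exact (congrArg elem (map_mul φ a b)).trans (congrArg₂ _ ha hb)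
    · intro a ha
      exact (congrArg elem (InverseMonoid.map_inv φ a)).trans (congrArg _ ha)
  exact (hmax a).trans (of_eq_of _ _ (congrArg (fun g => c'.cl (Sub.pairSub ι 1 g)) ha) ha)

/-- The `F`-inverse monoid of a closure operator on all subgraphs. -/
def fInverseOver (hι : Subgroup.closure (Set.range ι) = ⊤) (c : InvariantClosure ι ⊤) :
    FInverseOver ι where
  carrier := ClosedPair c
  gen := gen c
  generated T hgen hone hmul hinv hmax := Set.eq_univ_of_forall fun a => by
    have hjump {g : G} (hg : g ∈ (⊤ : Subgroup G)) : of c (.jump hg) ∈ T := by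
      obtain ⟨a, ha, rfl⟩ :=
        exists_mem_map_eq hι (π := proj c) (ClosedPair.proj_gen c) hgen hone hmul hinv g
      exact hmax a ha
    obtain ⟨F, hF, ha⟩ := a.exists_eq_of
    exact ha ▸ of_mem hgen hjump hmul hinv hF
  proj := proj c
  proj_gen := ClosedPair.proj_gen c
  proj_greatest := (idempotentPure_proj c).isGreatestGroupImage (proj_surjective hι c)

end FInverse

end ClosedPair

section Functors

variable (hι : Subgroup.closure (Set.range ι) = ⊤)

/-- The functor of part 1, from closure operators to `E`-unitary inverse monoids. -/
def eUnitaryFunctor : InvariantClosure ι ⊥ ⥤ EUnitaryOver ι where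
  obj := ClosedPair.eUnitaryOver hι
  map f := ⟨ClosedPair.map f.le, InverseMonoid.map_inv _, ClosedPair.map_gen f.le⟩
  map_id _ := EUnitaryOver.Hom.ext ClosedPair.map_refl
  map_comp f g := EUnitaryOver.Hom.ext (ClosedPair.map_trans f.le g.le)

instance : (eUnitaryFunctor hι).IsEquivalence where
  full := ⟨fun {c c'} f => by
    have hjump {g : G} (hg : g ∈ (⊥ : Subgroup G)) :
        f.toMonoidHom (ClosedPair.of c (.jump hg)) = ClosedPair.of c' (.jump hg) := by
      rw [ClosedPair.jump_bot hg, ClosedPair.jump_bot hg]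
      exact map_one f.toMonoidHom
    have hle : c ≤ c' := ClosedPair.le_of_hom f.toMonoidHom f.map_gen hjump
    exact ⟨homOfLE hle,
      EUnitaryOver.Hom.ext (ClosedPair.eq_map f.toMonoidHom f.map_gen hjump hle).symm⟩⟩
  essSurj := ⟨fun S => ⟨S.isModel.closure, ⟨.symm <|
    EUnitaryOver.isoOfMulEquiv S.isModel.mulEquivClosedPair S.isModel.mulEquivClosedPair_gen⟩⟩⟩

/-- The functor of part 2, from closure operators to `F`-inverse monoids. -/
def fInverseFunctor : InvariantClosure ι ⊤ ⥤ FInverseOver ι where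
  obj := ClosedPair.fInverseOver hι
  map f := ⟨ClosedPair.map f.le, InverseMonoid.map_inv _, fun _ => ClosedPair.map_of f.le _,
    ClosedPair.map_gen f.le⟩
  map_id _ := FInverseOver.Hom.ext ClosedPair.map_refl
  map_comp f g := FInverseOver.Hom.ext (ClosedPair.map_trans f.le g.le)

instance : (fInverseFunctor hι).IsEquivalence where
  full := ⟨fun {c c'} f => by
    have hjump {g : G} (hg : g ∈ (⊤ : Subgroup G)) :
        f.toMonoidHom (ClosedPair.of c (.jump hg)) = ClosedPair.of c' (.jump hg) :=
      ClosedPair.map_jump_top hι f.toMonoidHom f.map_gen f.map_maxElt hg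
    have hle : c ≤ c' := ClosedPair.le_of_hom f.toMonoidHom f.map_gen hjump
    exact ⟨homOfLE hle,
      FInverseOver.Hom.ext (ClosedPair.eq_map f.toMonoidHom f.map_gen hjump hle).symm⟩⟩
  essSurj := ⟨fun S => ⟨S.isModel.closure, ⟨.symm <|
    FInverseOver.isoOfMulEquiv S.isModel.mulEquivClosedPair S.isModel.mulEquivClosedPair_gen
      S.isModel.proj_mulEquivClosedPair⟩⟩⟩

end Functors

end Cayley

theorem mainTheorem1 {X : Type u} {G : Type v} [Group G] (ι : X → G)
    (hι : Subgroup.closure (Set.range ι) = ⊤) :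
    Nonempty (EUnitaryOver ι ≌ Cayley.ClosureC ι) ∧
      Nonempty (FInverseOver ι ≌ Cayley.ClosureS ι) :=
  ⟨⟨(Cayley.eUnitaryFunctor hι).asEquivalence.symm.trans
      Cayley.InvariantClosure.orderIsoClosureC.equivalence⟩,
    ⟨(Cayley.fInverseFunctor hι).asEquivalence.symm.trans
      Cayley.InvariantClosure.orderIsoClosureS.equivalence⟩⟩
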